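/- **Staircase tableaux.** A staircase tableau $\mathcal T$ of size $n\ge 0$ is a Ferrers diagram of shape $(n,n-1,\dots,1)$ (top row longest, left-justified) whose boxes are empty or labeled $\alpha,\beta,\gamma$ or $\delta$, such that no diagonal (i.e. last in its row) box is empty, all boxes to the left of a $\beta$ or $\delta$ in its row are empty, and all boxes above an $\alpha$ or $\gamma$ in its column are empty. A box "sees" to its right (below it) the closest labeled box to its right in its row (below it in its column). A blank box has weight $q$ if it sees a $\delta$ to its right, or if it sees an $\alpha$ or $\gamma$ to its right and a $\beta$ or $\gamma$ below it; all other blank boxes have weight $1$. A row is indexed by its left-most label, a column by its top-most label. **Lazy paths.** A lazy path of size $n$ is a lattice path from $(0,0)$ to $(2n,0)$ with steps $(1,1)$, $(1,-1)$ and $(2,0)$, whose steps $(2,0)$ all lie on the horizontal axis. A factor of a path is a minimal nonempty sub-path starting and ending on the axis; it is negative if it is strictly below the axis between its ends (a step $(2,0)$ on the axis is not negative). **The map $\Phi$.** Let $\mathcal T$ be a staircase tableau of size $n$ without label $\delta$ and without weight $q$. 1. Add a row above $\mathcal T$ and a column to its left so as to obtain a staircase diagram with rows of lengths $n+2,n+1,\dots,1$.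 In the added first row and column, put a label $1$ in the corner, in the last box of the first row, in the last box of the first column, in the first-row box above every column indexed by $\beta$ (or $\delta$), and in the first-column box to the left of every row indexed by $\alpha$ or $\gamma$. 2. Form a binary tree whose nodes are the labels, rooted at the corner: the left son of a non-diagonal label is the closest label below it, its right son is the closest label to its right, and diagonal labels are the external nodes (leaves). Go around the tree, starting at the root and visiting left before right; record $(1,1)$ for an internal node and $(1,-1)$ for an external node, at its first visit, omitting the root and the last two external nodes. 3. In this path, replace every negative factor by a step $(2,0)$. Reflect in the axis every positive factor whose first step comes from a node whose right son is labeled $\gamma$, and leave all other positive factors unchanged. The result is $\Phi(\mathcal T)$. **Proposition.** $\Phi$ is a bijection from the set of staircase tableaux of size $n$ without label $\delta$ and without weight $q$ onto the set of lazy paths of size $n$. Moreover, for a lazy path $P$, let $D(P)$, $M(P)$, $H(P)$ be the numbers of its steps $(1,-1)$, $(1,1)$, $(2,0)$, let $N(P)$ be the number of its negative factors, and let $A(P)$ be the length of its initial maximal sequence of steps $(1,1)$ or, if $P$ begins with a negative factor, of steps $(1,-1)$ (so $A(P)=0$ if $P$ is empty or begins with $(2,0)$). Then, for every such $\mathcal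 T$ and $P=\Phi(\mathcal T)$: - the number of $\gamma$ labels in $\mathcal T$ is $N(P)$; - the number of $\alpha$ labels in $\mathcal T$ is $M(P)-N(P)$; - the number of $\beta$ labels in $\mathcal T$ is $D(P)+H(P)-A(P)$; - the number of columns of $\mathcal T$ indexed by $\beta$ is $H(P)$; - the number of rows of $\mathcal T$ indexed by $\alpha$ or $\gamma$ is $A(P)$. -/

import Mathlib

namespace Staircase

/-! Staircase tableaux -/

/-- The four labels `α`, `β`, `γ`, `δ`. -/
inductive Label
  | α | β | γ | δ
  deriving DecidableEq

/-- Staircase tableaux of size `n`. The box in row `i` (counted from the top) and column `j`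
(counted from the left), both starting at `0`, belongs to the shape `(n, n - 1, …, 1)` iff
`i + j < n`, and it is on the diagonal iff `i + j + 1 = n`. -/
@[ext]
structure Tableau (n : ℕ) where
  /-- the content of a box, `none` for an empty box (and outside the shape) -/
  label : ℕ → ℕ → Option Label
  outside : ∀ i j, n ≤ i + j → label i j = none
  diagonal : ∀ i j, i + j + 1 = n → label i j ≠ none
  left_empty : ∀ i j k, label i j = some Label.β ∨ label i j = some Label.δ → k < j →
    label i k = none
  above_empty : ∀ i j k, label i j = some Label.α ∨ label i j = some Label.γ → k < i →
    label k j = none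

variable {n : ℕ}

namespace Tableau

/-- The label of the closest labeled box to the right of box `(i, j)` in row `i`. -/
def seesRight (T : Tableau n) (i j : ℕ) : Option Label :=
  (List.range n).findSome? fun k => if j < k then T.label i k else none

/-- The label of the closest labeled box below box `(i, j)` in column `j`. -/
def seesBelow (T : Tableau n) (i j : ℕ) : Option Label :=
  (List.range n).findSome? fun k => if i < k then T.label k j else none

/-- The left-most label of row `i`: row `i` is indexed by this label. -/
def rowIndex (T : Tableau n) (i : ℕ) : Option Label :=
  (List.range n).findSome? fun k => T.label i k

/-- The top-most label of column `j`: column `j` is indexed by this label. -/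
def colIndex (T : Tableau n) (j : ℕ) : Option Label :=
  (List.range n).findSome? fun k => T.label k j

/-- The box `(i, j)` is a blank box which is assigned the weight `q`: it sees a `δ` to its right,
or it sees an `α` or a `γ` to its right and a `β` or a `γ` below it. -/
def GetsQ (T : Tableau n) (i j : ℕ) : Prop :=
  i + j < n ∧ T.label i j = none ∧
    (T.seesRight i j = some Label.δ ∨
      ((T.seesRight i j = some Label.α ∨ T.seesRight i j = some Label.γ) ∧
        (T.seesBelow i j = some Label.β ∨ T.seesBelow i j = some Label.γ)))

/-- There is no label `δ` and no weight `q` in `T`. -/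
def NoDeltaNoQ (T : Tableau n) : Prop :=
  (∀ i j, T.label i j ≠ some Label.δ) ∧ ∀ i j, ¬ T.GetsQ i j

/-- The number of boxes of `T` with label `x`. -/
def numLabel (T : Tableau n) (x : Label) : ℕ :=
  ((Finset.range n ×ˢ Finset.range n).filter fun c => T.label c.1 c.2 = some x).card

/-- The number of columns indexed by `β`. -/
def numColBeta (T : Tableau n) : ℕ :=
  ((Finset.range n).filter fun j => T.colIndex j = some Label.β).card

/-- The number of rows indexed by `α` or `γ`. -/
def numRowAlphaGamma (T : Tableau n) : ℕ :=
  ((Finset.range n).filter fun i =>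
    T.rowIndex i = some Label.α ∨ T.rowIndex i = some Label.γ).card

end Tableau

/-! Factors of lattice paths -/

/-- The final ordinate of a path from the origin, when the step `s` rises by `rise s`. -/
def height {σ : Type} (rise : σ → ℤ) (p : List σ) : ℤ :=
  (p.map rise).sum

/-- Auxiliary function for `factors`: `h` is the current ordinate and `acc` is the part of the
current factor that was already read. -/
def factorsAux {σ : Type} (rise : σ → ℤ) : ℤ → List σ → List σ → List (List σ)
  | _, [], [] => []
  | _, s :: acc, [] => [s :: acc]
  | h, acc, s :: p =>
    if h + rise s = 0 then (acc ++ [s]) :: factorsAux rise 0 [] p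
    else factorsAux rise (h + rise s) (acc ++ [s]) p

/-- The factors of a path that ends on the axis, from left to right. A factor is a minimal
sub-path starting from the axis and ending on the axis, so the path is cut at each of its returns
to the axis. -/
def factors {σ : Type} (rise : σ → ℤ) (p : List σ) : List (List σ) :=
  factorsAux rise 0 [] p

/-- A factor is negative if it is strictly below the axis between its two ends. (A single step
along the axis is not negative.) -/
def IsNegative {σ : Type} (rise : σ → ℤ) (f : List σ) : Prop :=
  2 ≤ f.length ∧ ∀ k ∈ Finset.Ioo 0 f.length, height rise (f.take k) < 0

instance {σ : Type} (rise : σ → ℤ) : DecidablePred (IsNegative rise) := fun _ =>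
  inferInstanceAs (Decidable (_ ∧ _))

/-! Lazy paths -/

/-- The steps `(1, 1)`, `(1, -1)` and `(2, 0)`. -/
inductive Step
  | up | down | flat
  deriving DecidableEq

namespace Step

/-- The vector of a step. -/
def vec : Step → ℤ × ℤ
  | up => (1, 1)
  | down => (1, -1)
  | flat => (2, 0)

/-- The ordinate of the vector of a step. -/
def rise (s : Step) : ℤ := s.vec.2

/-- Mirror reflection of a step through the axis. -/
def mirror : Step → Step
  | up => down
  | down => up
  | flat => flat

end Step

/-- `p`, read as a path from `(0, 0)`, is a lazy path of size `n`: it ends at `(2n, 0)` and its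
steps `(2, 0)` lie on the axis. -/
def IsLazyPath (n : ℕ) (p : List Step) : Prop :=
  (p.map Step.vec).sum = (2 * (n : ℤ), 0) ∧
    ∀ a b : List Step, p = a ++ Step.flat :: b → height Step.rise a = 0

/-- The number of negative factors. -/
def numNegative (p : List Step) : ℕ :=
  (factors Step.rise p).countP fun f => decide (IsNegative Step.rise f)

/-- The length of the initial maximal sequence of equal diagonal steps: of steps `(1, 1)`, or of
steps `(1, -1)` if the path begins with a negative factor. At most one of the two summands is
nonzero. -/
def initialRun (p : List Step) : ℕ :=
  (p.takeWhile fun s => decide (s = Step.up)).length +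
    (p.takeWhile fun s => decide (s = Step.down)).length

/-! The map `Φ` -/

/-- Labels of the nodes of the tree of a tableau: `1` or a label of the tableau. -/
inductive NodeLabel
  | one
  | lab (x : Label)
  deriving DecidableEq

/-- The tableau `T` with a hook added to its left and above it: box `(i, j)` of `T` becomes
box `(i + 1, j + 1)` of a staircase whose diagonal is `i + j = n + 1`.
In the hook, the label `1` is put in the corner (root), in the two ends, in the first row
above each column indexed by `β` or `δ`, and in the first column to the left of each row indexed
by `α` or `γ`.

The labeled tree-like tableau of `T` is obtained from this by deleting, for each diagonal label
`α` or `γ` (resp. `β` or `δ`), its column (resp. row), which has no other label, and moving the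
label to the border edge that is created. The relative positions of the labels in rows and columns
are the same, and the border edges are represented here by the boxes of the diagonal. -/
def Tableau.hooked (T : Tableau n) : ℕ → ℕ → Option NodeLabel
  | 0, 0 => some NodeLabel.one
  | 0, j + 1 =>
    if j = n ∨ T.colIndex j = some Label.β ∨ T.colIndex j = some Label.δ then
      some NodeLabel.one else none
  | i + 1, 0 =>
    if i = n ∨ T.rowIndex i = some Label.α ∨ T.rowIndex i = some Label.γ then
      some NodeLabel.one else none
  | i + 1, j + 1 => (T.label i j).map NodeLabel.lab

/-- The column of the closest label to the right of `(i, j)` in `T.hooked`. -/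
def Tableau.nextRight (T : Tableau n) (i j : ℕ) : Option ℕ :=
  (List.range (n + 2)).find? fun k => decide (j < k) && (T.hooked i k).isSome

/-- The row of the closest label below `(i, j)` in `T.hooked`. -/
def Tableau.nextBelow (T : Tableau n) (i j : ℕ) : Option ℕ :=
  (List.range (n + 2)).find? fun k => decide (i < k) && (T.hooked k j).isSome

/-- The subtree at the label in box `(i, j)`: the left son of a label is the closest label below
it and the right son is the closest label to its right. The labels on the diagonal have no sons
and are the external nodes `nil`; the internal nodes are `node x l r` with left son `l` and right
son `r`, and `x` is the label of the right son, shifted to its father. The first argument bounds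
the depth; it is at least `n + 1 - (i + j)` in all calls that matter. -/
def Tableau.treeAt (T : Tableau n) : ℕ → ℕ → ℕ → BinaryTree NodeLabel
  | 0, _, _ => BinaryTree.nil
  | d + 1, i, j =>
    match T.nextBelow i j, T.nextRight i j with
    | some i', some j' =>
      BinaryTree.node ((T.hooked i j').getD NodeLabel.one) (T.treeAt d i' j) (T.treeAt d i j')
    | _, _ => BinaryTree.nil

/-- The binary tree of `T`, with `n + 1` internal nodes. -/
def Tableau.tree (T : Tableau n) : BinaryTree NodeLabel := T.treeAt (n + 1) 0 0

/-- Steps of the path around a binary tree: `up x` for an internal node carrying the label `x`,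
`down` for an external node. -/
inductive TourStep
  | up (x : NodeLabel)
  | down
  deriving DecidableEq

/-- Steps `up x` are `(1, 1)` and steps `down` are `(1, -1)`. -/
def TourStep.toStep : TourStep → Step
  | up _ => Step.up
  | down => Step.down

/-- The ordinate of a step. -/
def TourStep.rise (s : TourStep) : ℤ := s.toStep.rise

/-- Going around the tree, each node being recorded at its first visit. -/
def tour : BinaryTree NodeLabel → List TourStep
  | BinaryTree.nil => [TourStep.down]
  | BinaryTree.node x l r => TourStep.up x :: (tour l ++ tour r)

/-- The almost-Dyck path of a tree: the root and the last two external nodes are omitted. -/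
def almostDyck (t : BinaryTree NodeLabel) : List TourStep :=
  (tour t).tail.dropLast.dropLast

/-- A negative factor is replaced by a step `(2, 0)`; a positive factor is reflected if the label
of the node of its first step is `γ` and it is left unchanged otherwise. -/
def convertFactor (f : List TourStep) : List Step :=
  if IsNegative TourStep.rise f then [Step.flat]
  else if f.head? = some (TourStep.up (NodeLabel.lab Label.γ)) then
    f.map fun s => s.toStep.mirror
  else f.map TourStep.toStep

/-- The map `Φ` from staircase tableaux to paths. -/
def Φ (T : Tableau n) : List Step :=
  (factors TourStep.rise (almostDyck T.tree)).flatMap convertFactor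

end Staircase

/-! Both tableaux and lazy paths are encoded by the same binary trees with n + 1 internal nodes,
each carrying the label of its right son.

Tableau to tree. In the hooked diagram a β has nothing to its left and an α or γ has nothing above
it. So a left son is β, or 1 in the first column; a right son is α or γ, or 1 in the first row. The
absence of weight q leaves no label strictly between the left and right subtrees of a label
(`IsHooked.rectangle`), and makes those subtrees occupy adjacent stretches of the diagonal
(`IsHooked.sons_add`). The sizes of the subtrees therefore give the position of every label, and the
diagram is recovered by `paint` (`Tableau.hooked_eq_paint`). A γ below a row outside the hook would
also create a weight q unless its father lies on the right spine of a left subtree hanging from the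
first row. This is `Admissible`: 1 on the right spine of the tree, α or γ on the right spines of the
left subtrees hanging from it, α everywhere else. Conversely, in a painted admissible tree each
blank box outside the first row sees a β to its right or an α below it, hence never has weight q
(`Admissible.seesBetaOrAlpha`), so every admissible tree comes from a tableau
(`Admissible.exists_tableau`).

Tree to path. Without the root, the walk reads the Dyck word of the left subtree, then dips below
the axis and returns each time it moves on along the right spine. These dips are exactly the
negative factors, and become the flat steps; the remaining factors are opened by the nodes carrying
α or γ on the side right spines, and their orientation records which (`Φ_eq_spinePath`). Unique
readability of Dyck words makes this a bijection from admissible trees onto lazy paths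
(`spinePath_injOn`, `IsLazyPath.exists_tree`).

Statistics. Both sides are counted on the tree: γ and α are node labels, the β are the left sons
outside the first column, and the two hook statistics are lengths of the right and left spines minus
one. -/

namespace Staircase

open BinaryTree

/-! ### Cutting a path at its returns to the axis -/

section Height

variable {σ : Type} (rise : σ → ℤ)

@[simp] theorem height_nil : height rise [] = 0 := rfl

@[simp] theorem height_cons (s : σ) (p : List σ) :
    height rise (s :: p) = rise s + height rise p := by
  simp [height]

@[simp] theorem height_append (p q : List σ) :
    height rise (p ++ q) = height rise p + height rise q := by
  simp [height]

@[simp] theorem factors_nil : factors rise [] = [] := by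
  simp [factors, factorsAux]

theorem factorsAux_cons (h : ℤ) (acc : List σ) (s : σ) (p : List σ) :
    factorsAux rise h acc (s :: p) =
      if h + rise s = 0 then (acc ++ [s]) :: factorsAux rise 0 [] p
      else factorsAux rise (h + rise s) (acc ++ [s]) p := by
  cases acc <;> rw [factorsAux]

/-- As long as no proper prefix of `f` reaches the axis, the scan only moves letters to the
accumulator; the starting ordinate and the accumulator are free so that the induction can go
through. -/
theorem factorsAux_append (f : List σ) : ∀ (h : ℤ) (acc p : List σ), f ≠ [] →
    h + height rise f = 0 → (∀ k ∈ Finset.Ioo 0 f.length, h + height rise (f.take k) ≠ 0) →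
    factorsAux rise h acc (f ++ p) = (acc ++ f) :: factorsAux rise 0 [] p := by
  induction f with
  | nil => intro h acc p hf; exact absurd rfl hf
  | cons s f ih =>
    intro h acc p _ h0 hk
    rw [List.cons_append, factorsAux_cons]
    by_cases hf : f = []
    · subst hf
      simp only [height_cons, height_nil, add_zero] at h0
      simp [h0]
    · have hpos : 0 < f.length := List.length_pos_iff.2 hf
      have h1 : h + rise s ≠ 0 := by
        simpa using hk 1 (by simp [hpos])
      rw [if_neg h1, ih _ _ _ hf (by rw [← h0, height_cons]; ring)]
      · simp
      · intro k hk'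
        have := hk (k + 1) (by simp at hk' ⊢; omega)
        simpa [add_assoc] using this

theorem factors_append (f p : List σ) (hf : f ≠ []) (h0 : height rise f = 0)
    (hk : ∀ k ∈ Finset.Ioo 0 f.length, height rise (f.take k) ≠ 0) :
    factors rise (f ++ p) = f :: factors rise p := by
  unfold factors
  rw [factorsAux_append rise f 0 [] p hf (by simpa using h0) (by simpa using hk)]
  simp

end Height

/-! Words of binary trees -/

section Dyck

variable {σ : Type}

/-- The Dyck word of a binary tree, with letter `u x` for a node carrying `x`, and `d` for the
matching closing letter. -/
def dyck (u : NodeLabel → σ) (d : σ) : BinaryTree NodeLabel → List σ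
  | nil => []
  | node x a b => u x :: (dyck u d a ++ d :: dyck u d b)

/-- The prime factor of a Dyck word which is opened by a node carrying `x`, with left subtree
`a`. -/
def prime (u : NodeLabel → σ) (d : σ) (x : NodeLabel) (a : BinaryTree NodeLabel) : List σ :=
  u x :: (dyck u d a ++ [d])

/-- The prime factors of a Dyck word. -/
def primes (u : NodeLabel → σ) (d : σ) : BinaryTree NodeLabel → List (List σ)
  | nil => []
  | node x a b => prime u d x a :: primes u d b

variable {rise : σ → ℤ} {u : NodeLabel → σ} {d : σ} {c : ℤ}

theorem height_dyck (hu : ∀ x, rise (u x) = c) (hd : rise d = -c) (t : BinaryTree NodeLabel) :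
    height rise (dyck u d t) = 0 := by
  induction t with
  | nil => rfl
  | node x a b iha ihb => simp [dyck, hu, hd, iha, ihb]

/-- The rise `c` of the opening letter is kept arbitrary so that words above the axis and their
reflections are treated at once; a prefix stays weakly on the side of `c`. -/
theorem height_take_dyck (hu : ∀ x, rise (u x) = c) (hd : rise d = -c)
    (t : BinaryTree NodeLabel) :
    ∀ k, ∃ m : ℕ, height rise ((dyck u d t).take k) = c * m := by
  induction t with
  | nil => intro k; exact ⟨0, by simp [dyck]⟩
  | node x a b iha ihb =>
    intro k
    rcases k with _ | k
    · exact ⟨0, by simp⟩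
    simp only [dyck, List.take_succ_cons, height_cons, List.take_append, height_append, hu]
    -- Either the cut falls no later than the end of the word of `a`, one level off the axis, or the
    -- closing letter has been read and the rest is a prefix of the word of `b`.
    rcases hj : k - (dyck u d a).length with _ | j
    · obtain ⟨m, hm⟩ := iha k
      exact ⟨m + 1, by rw [hm]; simp; ring⟩
    · obtain ⟨m, hm⟩ := ihb j
      refine ⟨m, ?_⟩
      rw [List.take_of_length_le (by omega), height_dyck hu hd]
      simp [hd, hm]

theorem height_prime (hu : ∀ x, rise (u x) = c) (hd : rise d = -c) (x : NodeLabel)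
    (a : BinaryTree NodeLabel) : height rise (prime u d x a) = 0 := by
  simp [prime, hu, hd, height_dyck hu hd]

/-- Before the last letter the opening letter is still unclosed, which adds one level: hence `m + 1`
and a strict excursion. -/
theorem height_take_prime (hu : ∀ x, rise (u x) = c) (hd : rise d = -c) (x : NodeLabel)
    (a : BinaryTree NodeLabel) (k : ℕ) (hk : k ∈ Finset.Ioo 0 (prime u d x a).length) :
    ∃ m : ℕ, height rise ((prime u d x a).take k) = c * (m + 1) := by
  obtain ⟨h0, h1⟩ := Finset.mem_Ioo.1 hk
  obtain ⟨k, rfl⟩ : ∃ l, k = l + 1 := ⟨k - 1, by omega⟩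
  obtain ⟨m, hm⟩ := height_take_dyck hu hd a k
  refine ⟨m, ?_⟩
  have : k - (dyck u d a).length = 0 := by simp [prime] at h1; omega
  simp [prime, List.take_append, this, hm, hu]
  ring

theorem factors_prime_append (hc : c ≠ 0) (hu : ∀ x, rise (u x) = c) (hd : rise d = -c)
    (x : NodeLabel) (a : BinaryTree NodeLabel) (p : List σ) :
    factors rise (prime u d x a ++ p) = prime u d x a :: factors rise p := by
  refine factors_append rise _ p (by simp [prime]) (height_prime hu hd x a) ?_
  intro k hk
  obtain ⟨m, hm⟩ := height_take_prime hu hd x a k hk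
  rw [hm]
  exact mul_ne_zero hc (by positivity)

theorem dyck_node (x : NodeLabel) (a b : BinaryTree NodeLabel) :
    dyck u d (node x a b) = prime u d x a ++ dyck u d b := by
  simp [dyck, prime]

theorem factors_dyck_append (hc : c ≠ 0) (hu : ∀ x, rise (u x) = c) (hd : rise d = -c)
    (t : BinaryTree NodeLabel) (p : List σ) :
    factors rise (dyck u d t ++ p) = primes u d t ++ factors rise p := by
  induction t with
  | nil => simp [dyck, primes]
  | node x a b _ ihb =>
    rw [dyck_node, List.append_assoc, factors_prime_append hc hu hd, ihb]
    simp [primes]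

theorem isNegative_prime (hu : ∀ x, rise (u x) = c) (hd : rise d = -c)
    (x : NodeLabel) (a : BinaryTree NodeLabel) :
    IsNegative rise (prime u d x a) ↔ c < 0 := by
  constructor
  · rintro ⟨-, h⟩
    have h1 := h 1 (by simp [prime])
    simpa [prime, hu] using h1
  · intro hc
    refine ⟨by simp [prime], ?_⟩
    intro k hk
    obtain ⟨m, hm⟩ := height_take_prime hu hd x a k hk
    rw [hm]
    exact mul_neg_of_neg_of_pos hc (by positivity)

theorem map_dyck {τ : Type} (g : σ → τ) (t : BinaryTree NodeLabel) :
    (dyck u d t).map g = dyck (fun x => g (u x)) (g d) t := by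
  induction t with
  | nil => rfl
  | node x a b iha ihb => simp [dyck, iha, ihb]

end Dyck

/-! The map `Φ` on trees -/

/-- The letter that opens the factor of a node carrying `x`. -/
def opening (x : NodeLabel) : Step :=
  if x = NodeLabel.lab Label.γ then Step.down else Step.up

/-- The letter that closes the factor of a node carrying `x`. -/
def closing (x : NodeLabel) : Step :=
  if x = NodeLabel.lab Label.γ then Step.up else Step.down

/-- The converted Dyck word of a left subtree of the right spine. -/
def sidePath : BinaryTree NodeLabel → List Step
  | nil => []
  | node x a b => prime (fun _ => opening x) (closing x) x a ++ sidePath b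

/-- The lazy path of a tree. -/
def spinePath : BinaryTree NodeLabel → List Step
  | nil => []
  | node _ l nil => sidePath l
  | node _ l (node y a b) => sidePath l ++ Step.flat :: spinePath (node y a b)

/-- The last leaf of a left subtree serves as the closing letter of its father; only the very last
leaf of the tree is unmatched. -/
theorem tour_eq (t : BinaryTree NodeLabel) :
    tour t = dyck TourStep.up TourStep.down t ++ [TourStep.down] := by
  induction t with
  | nil => rfl
  | node x a b iha ihb => simp [tour, dyck, iha, ihb]

theorem almostDyck_leaf (x : NodeLabel) (l : BinaryTree NodeLabel) :
    almostDyck (node x l nil) = dyck TourStep.up TourStep.down l := by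
  simp [almostDyck, tour_eq, dyck]

/-- As the root is omitted, the last leaf of `l` steps below the axis and the next node of the right
spine steps back at once. -/
theorem almostDyck_node (x y : NodeLabel) (l a b : BinaryTree NodeLabel) :
    almostDyck (node x l (node y a b)) =
      dyck TourStep.up TourStep.down l ++ TourStep.down :: TourStep.up y ::
        almostDyck (node y a b) := by
  have h : almostDyck (node y a b) = (tour a ++ tour b).dropLast.dropLast := by
    simp [almostDyck, tour]
  -- The two omitted leaves already belong to the walks of `a` and `b`, so the truncation is the
  -- same for the whole tree and for its right subtree.
  obtain ⟨s, s', q, hq⟩ : ∃ s s' q, tour a ++ tour b = q ++ [s, s'] := by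
    rw [tour_eq a, tour_eq b]
    rcases List.eq_nil_or_concat (dyck TourStep.up TourStep.down b) with h | ⟨q, s, h⟩
    · exact ⟨_, _, _, by rw [h]; simp; rfl⟩
    · exact ⟨s, TourStep.down, dyck TourStep.up TourStep.down a ++ [TourStep.down] ++ q, by simp [h]⟩
  have h' : almostDyck (node x l (node y a b)) =
      (tour l ++ TourStep.up y :: (tour a ++ tour b)).dropLast.dropLast := by
    simp [almostDyck, tour]
  have e (p : List TourStep) : (p ++ [s, s']).dropLast.dropLast = p := by
    have : p ++ [s, s'] = (p ++ [s]) ++ [s'] := by simp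
    rw [this, List.dropLast_concat, List.dropLast_concat]
  rw [h, h', hq, e, tour_eq l]
  have : dyck TourStep.up TourStep.down l ++ [TourStep.down] ++ TourStep.up y :: (q ++ [s, s'])
    = (dyck TourStep.up TourStep.down l ++ TourStep.down :: TourStep.up y :: q) ++ [s, s'] := by
    simp
  rw [this, e]

theorem rise_tour_up (x : NodeLabel) : TourStep.rise (TourStep.up x) = 1 := rfl

theorem rise_tour_down : TourStep.rise TourStep.down = -1 := rfl

theorem rise_opening (x : NodeLabel) :
    (opening x).rise = if x = NodeLabel.lab Label.γ then -1 else 1 := by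
  unfold opening; split_ifs <;> rfl

theorem rise_closing (x : NodeLabel) : (closing x).rise = -(opening x).rise := by
  unfold opening closing; split_ifs <;> rfl

theorem rise_opening_ne_zero (x : NodeLabel) : (opening x).rise ≠ 0 := by
  rw [rise_opening]; split_ifs <;> decide

theorem convertFactor_prime (x : NodeLabel) (a : BinaryTree NodeLabel) :
    convertFactor (prime TourStep.up TourStep.down x a) =
      prime (fun _ => opening x) (closing x) x a := by
  have hn : ¬ IsNegative TourStep.rise (prime TourStep.up TourStep.down x a) := by
    rw [isNegative_prime rise_tour_up rise_tour_down]; decide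
  unfold convertFactor
  rw [if_neg hn]
  by_cases hx : x = NodeLabel.lab Label.γ
  · simp [prime, hx, map_dyck, opening, closing, TourStep.toStep, Step.mirror]
  · simp [prime, hx, map_dyck, opening, closing, TourStep.toStep]

theorem convert_primes (t : BinaryTree NodeLabel) :
    (primes TourStep.up TourStep.down t).flatMap convertFactor = sidePath t := by
  induction t with
  | nil => rfl
  | node x a b _ ihb => simp [primes, sidePath, convertFactor_prime, ihb]

/-- The pairs down-up between consecutive nodes of the right spine are the only negative factors;
all others are prime Dyck words, oriented by their first node. -/
theorem convert_almostDyck (t : BinaryTree NodeLabel) :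
    (factors TourStep.rise (almostDyck t)).flatMap convertFactor = spinePath t := by
  have hf (l : BinaryTree NodeLabel) (p : List TourStep) :=
    factors_dyck_append (by decide) rise_tour_up rise_tour_down l p
  induction t using spinePath.induct with
  | case1 => simp [almostDyck, tour, spinePath]
  | case2 x l =>
    have := hf l []
    simp only [List.append_nil, factors_nil] at this
    rw [almostDyck_leaf, this, convert_primes, spinePath]
  | case3 x l y a b ih =>
    rw [almostDyck_node, hf, List.flatMap_append, convert_primes, spinePath]
    have h2 := factors_append TourStep.rise [TourStep.down, TourStep.up y]
      (almostDyck (node y a b)) (by simp) rfl (by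
        intro k hk
        obtain rfl : k = 1 := by simp at hk; omega
        simp [rise_tour_down])
    have h3 : IsNegative TourStep.rise [TourStep.down, TourStep.up y] := by
      refine ⟨by simp, ?_⟩
      intro k hk
      obtain rfl : k = 1 := by simp at hk; omega
      simp [rise_tour_down]
    simp only [List.cons_append, List.nil_append] at h2
    rw [h2, List.flatMap_cons, ih]
    simp [convertFactor, h3]

theorem Φ_eq_spinePath {n : ℕ} (T : Tableau n) : Φ T = spinePath T.tree :=
  convert_almostDyck _

/-! Admissible trees -/

/-- All nodes carry `α`. -/
def AllAlpha : BinaryTree NodeLabel → Prop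
  | nil => True
  | node x l r => x = NodeLabel.lab Label.α ∧ AllAlpha l ∧ AllAlpha r

/-- The nodes of the right spine carry `α` or `γ`, all other nodes carry `α`. -/
def SideAdmissible : BinaryTree NodeLabel → Prop
  | nil => True
  | node x l r => (x = NodeLabel.lab Label.α ∨ x = NodeLabel.lab Label.γ) ∧
      AllAlpha l ∧ SideAdmissible r

/-- The nodes of the right spine carry `1`, and their left subtrees are side admissible. -/
def Admissible : BinaryTree NodeLabel → Prop
  | nil => True
  | node x l r => x = NodeLabel.one ∧ SideAdmissible l ∧ Admissible r

theorem AllAlpha.sideAdmissible {t : BinaryTree NodeLabel} (h : AllAlpha t) :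
    SideAdmissible t := by
  induction t with
  | nil => trivial
  | node x l r _ ihr => exact ⟨Or.inl h.1, h.2.1, ihr h.2.2⟩

/-- The number of nodes that carry `x`. -/
def labelCount (x : NodeLabel) : BinaryTree NodeLabel → ℕ
  | nil => 0
  | node y l r => (if y = x then 1 else 0) + labelCount x l + labelCount x r

/-- The number of nodes of the left spine. -/
def leftLength : BinaryTree NodeLabel → ℕ
  | nil => 0
  | node _ l _ => leftLength l + 1

/-- The number of nodes of the right spine. -/
def rightLength : BinaryTree NodeLabel → ℕ
  | nil => 0
  | node _ _ r => rightLength r + 1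

theorem AllAlpha.labelCount_gamma {t : BinaryTree NodeLabel} (h : AllAlpha t) :
    labelCount (NodeLabel.lab Label.γ) t = 0 := by
  induction t with
  | nil => rfl
  | node x l r ihl ihr => simp [labelCount, h.1, ihl h.2.1, ihr h.2.2]

theorem SideAdmissible.numNodes {t : BinaryTree NodeLabel} (h : SideAdmissible t) :
    t.numNodes = labelCount (NodeLabel.lab Label.α) t + labelCount (NodeLabel.lab Label.γ) t := by
  induction t with
  | nil => rfl
  | node x l r ihl ihr =>
    have h1 := ihl h.2.1.sideAdmissible
    have h2 := ihr h.2.2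
    rcases h.1 with hx | hx <;> simp [labelCount, hx] <;> omega

theorem Admissible.numNodes {t : BinaryTree NodeLabel} (h : Admissible t) :
    t.numNodes = labelCount (NodeLabel.lab Label.α) t + labelCount (NodeLabel.lab Label.γ) t +
      rightLength t := by
  induction t with
  | nil => rfl
  | node x l r _ ihr =>
    have h1 := h.2.1.numNodes
    have h2 := ihr h.2.2
    simp [labelCount, rightLength, h.1]; omega

/-! Statistics of the path of a tree -/

theorem opening_ne_flat (x : NodeLabel) : opening x ≠ Step.flat := by
  unfold opening; split_ifs <;> decide

theorem closing_ne_flat (x : NodeLabel) : closing x ≠ Step.flat := by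
  unfold closing; split_ifs <;> decide

theorem opening_ne_closing (x : NodeLabel) : opening x ≠ closing x := by
  unfold opening closing; split_ifs <;> decide

theorem count_dyck {x : NodeLabel} {s : Step} (hs : s ≠ Step.flat) (t : BinaryTree NodeLabel) :
    (dyck (fun _ => opening x) (closing x) t).count s = t.numNodes := by
  have : (opening x = s ∧ closing x ≠ s) ∨ (opening x ≠ s ∧ closing x = s) := by
    revert hs; unfold opening closing; split_ifs <;> cases s <;> decide
  induction t with
  | nil => rfl
  | node y a b iha ihb =>
    simp only [dyck, List.count_cons, List.count_append, iha, ihb, BinaryTree.numNodes]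
    rcases this with ⟨h1, h2⟩ | ⟨h1, h2⟩ <;> (simp [h1, h2]; try omega)

theorem count_prime {x : NodeLabel} {s : Step} (hs : s ≠ Step.flat)
    (a : BinaryTree NodeLabel) :
    (prime (fun _ => opening x) (closing x) x a).count s = a.numNodes + 1 := by
  have h := count_dyck (x := x) hs (node x a nil)
  rwa [dyck_node, dyck, List.append_nil] at h

theorem count_sidePath {s : Step} (hs : s ≠ Step.flat) (t : BinaryTree NodeLabel) :
    (sidePath t).count s = t.numNodes := by
  induction t with
  | nil => rfl
  | node x a b _ ihb => simp [sidePath, count_prime hs, ihb]; omega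

theorem flat_notMem_dyck (x : NodeLabel) (t : BinaryTree NodeLabel) :
    Step.flat ∉ dyck (fun _ => opening x) (closing x) t := by
  induction t with
  | nil => simp [dyck]
  | node y a b iha ihb =>
    simp [dyck, iha, ihb, (opening_ne_flat x).symm, (closing_ne_flat x).symm]

theorem flat_notMem_sidePath (t : BinaryTree NodeLabel) : Step.flat ∉ sidePath t := by
  induction t with
  | nil => simp [sidePath]
  | node x a b _ ihb =>
    simp [sidePath, prime, flat_notMem_dyck, ihb, (opening_ne_flat x).symm,
      (closing_ne_flat x).symm]

/-- Every node off the right spine gives one step up and one step down, whatever its orientation;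
right spine nodes give no diagonal step. -/
theorem count_spinePath {s : Step} (hs : s ≠ Step.flat) (t : BinaryTree NodeLabel) :
    (spinePath t).count s + rightLength t = t.numNodes := by
  induction t using spinePath.induct with
  | case1 => rfl
  | case2 x l => simp [spinePath, rightLength, count_sidePath hs]
  | case3 x l y a b ih =>
    have : (Step.flat == s) = false := by simpa using hs.symm
    simp only [spinePath, rightLength, List.count_append, count_sidePath hs, List.count_cons,
      this, BinaryTree.numNodes] at ih ⊢
    simp
    omega

theorem count_flat_spinePath (t : BinaryTree NodeLabel) :
    (spinePath t).count Step.flat = rightLength t - 1 := by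
  induction t using spinePath.induct with
  | case1 => rfl
  | case2 x l => simp [spinePath, rightLength, List.count_eq_zero, flat_notMem_sidePath]
  | case3 x l y a b ih =>
    simp [spinePath, rightLength, List.count_eq_zero_of_not_mem (flat_notMem_sidePath l), ih]

/-- A factor is negative exactly when the node that opens it carries γ, and the nodes inside factors
carry α, so they do not disturb the count. -/
theorem numNegative_sidePath_append {t : BinaryTree NodeLabel} (h : SideAdmissible t)
    (p : List Step) :
    numNegative (sidePath t ++ p) = labelCount (NodeLabel.lab Label.γ) t + numNegative p := by
  unfold numNegative
  induction t with
  | nil => simp [sidePath, labelCount]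
  | node x a b _ ihb =>
    rw [sidePath, List.append_assoc, factors_prime_append (rise_opening_ne_zero x)
      (fun _ => rfl) (rise_closing x), List.countP_cons, ihb h.2.2, labelCount,
      h.2.1.labelCount_gamma]
    simp only [decide_eq_true_eq, isNegative_prime (fun _ => rfl) (rise_closing x)]
    rw [rise_opening]
    split_ifs <;> (simp_all; try omega)

theorem numNegative_spinePath {t : BinaryTree NodeLabel} (h : Admissible t) :
    numNegative (spinePath t) = labelCount (NodeLabel.lab Label.γ) t := by
  induction t using spinePath.induct with
  | case1 => simp [spinePath, numNegative, labelCount]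
  | case2 x l =>
    have := numNegative_sidePath_append h.2.1 []
    simpa [spinePath, labelCount, numNegative, h.1] using this
  | case3 x l y a b ih =>
    rw [spinePath, numNegative_sidePath_append h.2.1, labelCount, ← ih h.2.2]
    have h2 := factors_append Step.rise [Step.flat] (spinePath (node y a b)) (by simp) rfl (by
        intro k hk
        simp at hk
        omega)
    simp only [List.cons_append, List.nil_append] at h2
    rw [numNegative, h2, List.countP_cons]
    simp [h.1, IsNegative, numNegative]

/-- The initial run descends the left spine until the first closing letter. The condition on `p`
matters when `t` is empty: `p` must not contribute a run of its own. -/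
theorem initialRun_sidePath_append (t : BinaryTree NodeLabel) (p : List Step)
    (hp : p = [] ∨ p.head? = some Step.flat) : initialRun (sidePath t ++ p) = leftLength t := by
  have key (x : NodeLabel) (a : BinaryTree NodeLabel) (q : List Step) :
      ((dyck (fun _ => opening x) (closing x) a ++ closing x :: q).takeWhile
        fun s => decide (s = opening x)).length = leftLength a := by
    induction a generalizing q with
    | nil => simp [dyck, leftLength, (opening_ne_closing x).symm]
    | node y a b iha ihb => simpa [dyck, leftLength] using iha _
  cases t with
  | nil =>
    rcases hp with rfl | hp
    · rfl
    · obtain ⟨q, rfl⟩ : ∃ q, p = Step.flat :: q := by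
        cases p <;> simp_all
      simp [sidePath, initialRun, leftLength]
  | node x a b =>
    have := key x a (sidePath b ++ p)
    simp only [sidePath, prime, leftLength, List.cons_append, List.append_assoc,
      List.nil_append, initialRun]
    unfold opening closing at *
    split_ifs with hx <;> simp_all

theorem initialRun_spinePath (t : BinaryTree NodeLabel) :
    initialRun (spinePath t) = leftLength t - 1 := by
  cases t with
  | nil => rfl
  | node x l r =>
    cases r with
    | nil => simpa [spinePath, leftLength] using initialRun_sidePath_append l [] (Or.inl rfl)
    | node y a b =>
      simpa [spinePath, leftLength] using initialRun_sidePath_append l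
        (Step.flat :: spinePath (node y a b)) (Or.inr rfl)

/-! Trees and lazy paths correspond -/

theorem flat_rise : Step.rise Step.flat = 0 := rfl

theorem height_sidePath (t : BinaryTree NodeLabel) : height Step.rise (sidePath t) = 0 := by
  induction t with
  | nil => rfl
  | node x a b _ ihb =>
    rw [sidePath, height_append, height_prime (fun _ => rfl) (rise_closing x), ihb, add_zero]

theorem vec_sum_spinePath (t : BinaryTree NodeLabel) (ht : t ≠ nil) :
    ((spinePath t).map Step.vec).sum = (2 * ((t.numNodes : ℤ) - 1), 0) := by
  have vsum (p : List Step) : (p.map Step.vec).sum =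
      (((p.count Step.up + p.count Step.down + 2 * p.count Step.flat : ℕ) : ℤ),
        height Step.rise p) := by
    induction p with
    | nil => rfl
    | cons s p ih =>
      rw [List.map_cons, List.sum_cons, ih]
      cases s <;> ext <;> simp [Step.vec, Step.rise] <;> ring
  have hh : height Step.rise (spinePath t) = 0 := by
    clear ht
    induction t using spinePath.induct with
    | case1 => rfl
    | case2 x l => exact height_sidePath l
    | case3 x l y a b ih => simp [spinePath, height_sidePath, flat_rise, ih]
  have h1 := count_spinePath (s := Step.up) (by decide) t
  have h2 := count_spinePath (s := Step.down) (by decide) t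
  have h3 := count_flat_spinePath t
  have h4 : 1 ≤ rightLength t := by
    cases t with
    | nil => exact absurd rfl ht
    | node x l r => simp [rightLength]
  rw [vsum, hh]
  congr 1
  omega

/-- All steps `(2, 0)` of `p` lie on the axis. -/
def FlatOnAxis (p : List Step) : Prop :=
  ∀ a b : List Step, p = a ++ Step.flat :: b → height Step.rise a = 0

theorem flatOnAxis_append {s p : List Step} (hs : Step.flat ∉ s)
    (h0 : height Step.rise s = 0) : FlatOnAxis (s ++ p) ↔ FlatOnAxis p := by
  constructor
  · intro h a b hab
    simpa [h0] using h (s ++ a) b (by simp [hab])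
  · intro h a b hab
    rcases List.append_eq_append_iff.1 hab with ⟨c, rfl, h2⟩ | ⟨c, rfl, h2⟩
    · simpa [h0] using h c b h2
    · cases c with
      | nil => simpa using h0
      | cons z c =>
        obtain ⟨rfl, -⟩ := List.cons.inj h2
        simp at hs

theorem flatOnAxis_flat_cons {p : List Step} : FlatOnAxis (Step.flat :: p) ↔ FlatOnAxis p := by
  constructor
  · intro h a b hab
    simpa [flat_rise] using h (Step.flat :: a) b (by simp [hab])
  · intro h a b hab
    cases a with
    | nil => rfl
    | cons z a =>
      obtain ⟨rfl, h2⟩ := List.cons.inj hab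
      simpa [flat_rise] using h a b h2

theorem flatOnAxis_nil : FlatOnAxis [] := by
  intro a b h
  simp at h

theorem flatOnAxis_spinePath (t : BinaryTree NodeLabel) : FlatOnAxis (spinePath t) := by
  induction t using spinePath.induct with
  | case1 => exact flatOnAxis_nil
  | case2 x l =>
    have := (flatOnAxis_append (flat_notMem_sidePath l) (height_sidePath l)).2 flatOnAxis_nil
    simpa [spinePath] using this
  | case3 x l y a b ih =>
    exact (flatOnAxis_append (flat_notMem_sidePath l) (height_sidePath l)).2
      (flatOnAxis_flat_cons.2 ih)

theorem isLazyPath_spinePath {n : ℕ} {t : BinaryTree NodeLabel} (ht : t.numNodes = n + 1) :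
    IsLazyPath n (spinePath t) := by
  refine ⟨?_, flatOnAxis_spinePath t⟩
  rw [vec_sum_spinePath t (by rintro rfl; simp at ht), ht]
  simp

/-- Unique readability of Dyck words. -/
theorem dyck_append_inj {σ : Type} {u : NodeLabel → σ} {d : σ} (hud : ∀ x, u x ≠ d) :
    ∀ {s t : BinaryTree NodeLabel}, AllAlpha s → AllAlpha t → ∀ {p q : List σ},
      dyck u d s ++ d :: p = dyck u d t ++ d :: q → s = t ∧ p = q := by
  intro s
  induction s with
  | nil =>
    intro t _ _ p q h
    cases t with
    | nil => simpa [dyck] using h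
    | node y a b => exact absurd (List.cons.inj h).1.symm (hud y)
  | node x a b iha ihb =>
    intro t hs ht p q h
    cases t with
    | nil => exact absurd (List.cons.inj h).1 (hud x)
    | node y a' b' =>
      simp only [dyck, List.cons_append, List.append_assoc, List.cons.injEq] at h
      obtain ⟨rfl, h1⟩ := iha hs.2.1 ht.2.1 h.2
      obtain ⟨rfl, rfl⟩ := ihb hs.2.2 ht.2.2 h1
      -- The letters need not record the labels: both nodes carry α.
      exact ⟨by rw [hs.1, ht.1], rfl⟩

/-- The first letter distinguishes three cases: up is a node with α, down a node with γ, and a flat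
step or the end of the path is the empty tree. -/
theorem sidePath_append_inj : ∀ {s t : BinaryTree NodeLabel}, SideAdmissible s →
    SideAdmissible t → ∀ {p q : List Step}, (p = [] ∨ p.head? = some Step.flat) →
      (q = [] ∨ q.head? = some Step.flat) → sidePath s ++ p = sidePath t ++ q →
      s = t ∧ p = q := by
  intro s
  induction s with
  | nil =>
    intro t _ _ p q hp hq h
    cases t with
    | nil => exact ⟨rfl, h⟩
    | node y a b =>
      simp only [sidePath, prime, List.nil_append, List.cons_append] at h
      simp [h, opening_ne_flat] at hp
  | node x a b _ ihb =>
    intro t hs ht p q hp hq h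
    cases t with
    | nil =>
      simp only [sidePath, prime, List.nil_append, List.cons_append] at h
      simp [← h, opening_ne_flat] at hq
    | node y a' b' =>
      simp only [sidePath, prime, List.cons_append, List.append_assoc, List.nil_append,
        List.cons.injEq] at h
      obtain rfl : x = y := by
        have h1 := h.1
        rcases hs.1 with rfl | rfl <;> rcases ht.1 with rfl | rfl <;>
          first
          | rfl
          | simp [opening] at h1
      obtain ⟨rfl, h2⟩ := dyck_append_inj (fun _ => opening_ne_closing x) hs.2.1 ht.2.1 h.2
      obtain ⟨rfl, rfl⟩ := ihb hs.2.2 ht.2.2 hp hq h2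
      exact ⟨rfl, rfl⟩

theorem spinePath_injOn {s t : BinaryTree NodeLabel} (hs : Admissible s) (ht : Admissible t)
    (hs0 : s ≠ nil) (ht0 : t ≠ nil) (h : spinePath s = spinePath t) : s = t := by
  induction s generalizing t with
  | nil => exact absurd rfl hs0
  | node x l r _ ihr =>
    cases t with
    | nil => exact absurd rfl ht0
    | node x' l' r' =>
      obtain rfl : x = x' := by rw [hs.1, ht.1]
      cases r with
      | nil =>
        cases r' with
        | nil =>
          obtain ⟨rfl, -⟩ := sidePath_append_inj (p := []) (q := []) hs.2.1 ht.2.1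
            (Or.inl rfl) (Or.inl rfl) (by simpa [spinePath] using h)
          rfl
        | node y' a' b' =>
          obtain ⟨-, h2⟩ := sidePath_append_inj (p := []) hs.2.1 ht.2.1
            (Or.inl rfl) (Or.inr rfl) (by simpa [spinePath] using h)
          simp at h2
      | node y a b =>
        cases r' with
        | nil =>
          obtain ⟨-, h2⟩ := sidePath_append_inj (q := []) hs.2.1 ht.2.1
            (Or.inr rfl) (Or.inl rfl) (by simpa [spinePath] using h)
          simp at h2
        | node y' a' b' =>
          obtain ⟨rfl, h2⟩ := sidePath_append_inj hs.2.1 ht.2.1 (Or.inr rfl) (Or.inr rfl) h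
          rw [ihr hs.2.2 ht.2.2 (by simp) (by simp) (List.cons.inj h2).2]

/-- A word that ends on the wrong side of the axis, and whose flat steps lie there, begins with a
Dyck word followed by its closing letter. -/
theorem exists_dyck_prefix (x : NodeLabel) : ∀ (m : ℕ) (w : List Step), w.length ≤ m →
    (opening x).rise * height Step.rise w < 0 →
    (∀ a b, w = a ++ Step.flat :: b → (opening x).rise * height Step.rise a < 0) →
    ∃ t q, AllAlpha t ∧ w = dyck (fun _ => opening x) (closing x) t ++ closing x :: q := by
  intro m
  induction m with
  | zero =>
    intro w hw h _
    obtain rfl : w = [] := by simpa using hw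
    simp at h
  | succ m ih =>
    intro w hw h hf
    cases w with
    | nil => simp at h
    | cons s w =>
      -- The rise is 1 or -1; this identity lets both orientations share the same linear
      -- inequalities.
      have hsq : (opening x).rise * (opening x).rise = 1 := by
        rw [rise_opening]; split_ifs <;> rfl
      have hs : s = Step.flat ∨ s = closing x ∨ s = opening x := by
        unfold opening closing; cases s <;> split_ifs <;> simp
      rcases hs with rfl | rfl | rfl
      -- A flat step cannot come first, since the starting point is strictly on the wrong side of
      -- where flat steps may lie.
      · simpa using hf [] w rfl
      · exact ⟨nil, w, trivial, rfl⟩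
      -- After an opening letter, the induction hypothesis is used twice: to close this letter, and
      -- then to find the closing letter of the whole word in the remainder.
      · obtain ⟨t, q, ht, rfl⟩ := ih w (by simpa using hw)
          (by rw [height_cons] at h; linarith)
          (by
            rintro a b rfl
            have := hf (opening x :: a) b rfl
            rw [height_cons] at this
            linarith)
        have h0 := height_dyck (rise := Step.rise) (u := fun _ => opening x) (fun _ => rfl)
          (rise_closing x) t
        obtain ⟨t', q', ht', rfl⟩ := ih q (by simp at hw; omega)
          (by
            rw [height_cons, height_append, height_cons, h0, rise_closing] at h
            linarith)
          (by
            rintro a b rfl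
            have := hf (opening x :: (dyck (fun _ => opening x) (closing x) t ++ closing x :: a)) b
              (by simp)
            rw [height_cons, height_append, height_cons, h0, rise_closing] at this
            linarith)
        exact ⟨node (NodeLabel.lab Label.α) t t', q', ⟨rfl, ht, ht'⟩, by simp [dyck]⟩

/-- The path is peeled from the left. A leading flat step adds a root with empty left subtree; a
leading factor adds a node at the top of the right spine of the root's left subtree. -/
theorem exists_spinePath_eq : ∀ (m : ℕ) (p : List Step), p.length ≤ m →
    height Step.rise p = 0 → FlatOnAxis p →
    ∃ l r, Admissible (node NodeLabel.one l r) ∧ spinePath (node NodeLabel.one l r) = p := by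
  intro m
  induction m with
  | zero =>
    intro p hp _ _
    obtain rfl : p = [] := by simpa using hp
    exact ⟨nil, nil, ⟨rfl, trivial, trivial⟩, rfl⟩
  | succ m ih =>
    intro p hp h0 hf
    cases p with
    | nil => exact ⟨nil, nil, ⟨rfl, trivial, trivial⟩, rfl⟩
    | cons s p =>
      by_cases hs : s = Step.flat
      · subst hs
        obtain ⟨l, r, h, rfl⟩ := ih p (by simpa using hp) (by simpa [flat_rise] using h0)
          (flatOnAxis_flat_cons.1 hf)
        exact ⟨nil, node NodeLabel.one l r, ⟨rfl, trivial, h⟩, by simp [spinePath, sidePath]⟩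
      · obtain ⟨x, hx, rfl⟩ : ∃ x, (x = NodeLabel.lab Label.α ∨ x = NodeLabel.lab Label.γ) ∧
            s = opening x := by
          cases s
          · exact ⟨_, Or.inl rfl, rfl⟩
          · exact ⟨_, Or.inr rfl, rfl⟩
          · exact absurd rfl hs
        have hsq : (opening x).rise * (opening x).rise = 1 := by
          rw [rise_opening]; split_ifs <;> rfl
        rw [height_cons] at h0
        obtain ⟨a, q, ha, rfl⟩ := exists_dyck_prefix x _ p le_rfl
          (by
            have : height Step.rise p = -(opening x).rise := by linarith
            rw [this]; linarith)
          (by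
            rintro a b rfl
            have := hf (opening x :: a) b rfl
            rw [height_cons] at this
            have : height Step.rise a = -(opening x).rise := by linarith
            rw [this]; linarith)
        have hd := height_dyck (rise := Step.rise) (u := fun _ => opening x) (fun _ => rfl)
          (rise_closing x) a
        have hq : height Step.rise q = 0 := by
          rw [height_append, height_cons, hd, rise_closing] at h0
          linarith
        have e : opening x :: (dyck (fun _ => opening x) (closing x) a ++ closing x :: q) =
            prime (fun _ => opening x) (closing x) x a ++ q := by simp [prime]
        rw [e] at hf ⊢
        have hf' : FlatOnAxis q := by
          refine (flatOnAxis_append ?_ (height_prime (fun _ => rfl) (rise_closing x) x a)).1 hf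
          simpa [sidePath] using flat_notMem_sidePath (node x a nil)
        obtain ⟨l, r, h, rfl⟩ := ih q (by simp at hp; omega) hq hf'
        refine ⟨node x a l, r, ⟨rfl, ⟨hx, ha, h.2.1⟩, h.2.2⟩, ?_⟩
        cases r <;> simp [spinePath, sidePath]

theorem IsLazyPath.exists_tree {n : ℕ} {p : List Step} (hp : IsLazyPath n p) :
    ∃ t, Admissible t ∧ t.numNodes = n + 1 ∧ spinePath t = p := by
  have h0 : height Step.rise p = 0 := by
    have h := congrArg Prod.snd hp.1
    have e : (p.map Step.vec).sum.2 = height Step.rise p := by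
      clear h hp
      induction p with
      | nil => rfl
      | cons s p ih => simp [ih, Step.rise]
    rw [← e, h]
  obtain ⟨l, r, h, rfl⟩ := exists_spinePath_eq _ p le_rfl h0 hp.2
  refine ⟨_, h, ?_, rfl⟩
  have h1 := congrArg Prod.fst (vec_sum_spinePath (node NodeLabel.one l r) (by simp))
  rw [hp.1] at h1
  simp only at h1
  omega

/-! Searching in ranges -/

theorem findSome?_range_eq_some {α : Type} (g : ℕ → Option α) (n : ℕ) (b : α) :
    (List.range n).findSome? g = some b ↔
      ∃ k, k < n ∧ g k = some b ∧ ∀ m < k, g m = none := by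
  induction n with
  | zero => simp
  | succ n ih =>
    rw [List.range_succ, List.findSome?_append]
    cases h : (List.range n).findSome? g with
    | some y =>
      rw [h] at ih
      simp only [Option.some_or]
      rw [ih]
      constructor
      · rintro ⟨k, hk, h1⟩
        exact ⟨k, by omega, h1⟩
      · rintro ⟨k, hk, h1, h2⟩
        refine ⟨k, ?_, h1, h2⟩
        by_contra hkn
        have : ∀ m ∈ List.range n, g m = none := fun m hm =>
          h2 m (by have := List.mem_range.1 hm; omega)
        rw [List.findSome?_eq_none_iff.2 this] at h
        cases h
    | none =>
      have h' := List.findSome?_eq_none_iff.1 h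
      simp only [List.mem_range] at h'
      simp only [Option.none_or, List.findSome?_singleton]
      constructor
      · intro hb
        exact ⟨n, by omega, hb, h'⟩
      · rintro ⟨k, hk, h1, h2⟩
        obtain rfl : k = n := by
          by_contra hkn
          rw [h' k (by omega)] at h1
          cases h1
        exact h1

theorem exists_last_lt {P : ℕ → Prop} {r : ℕ} (h : ∃ m < r, P m) :
    ∃ m < r, P m ∧ ∀ k, m < k → k < r → ¬ P k := by
  classical
  obtain ⟨m, hm, hP⟩ := h
  refine ⟨Nat.findGreatest P (r - 1), ?_, Nat.findGreatest_spec (by omega : m ≤ r - 1) hP, ?_⟩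
  · have := Nat.findGreatest_le (P := P) (r - 1)
    omega
  · intro k h1 h2
    exact Nat.findGreatest_is_greatest h1 (by omega)

theorem exists_first_gt {P : ℕ → Prop} {r : ℕ} (h : ∃ m, r < m ∧ P m) :
    ∃ m, r < m ∧ P m ∧ ∀ k, r < k → k < m → ¬ P k := by
  classical
  refine ⟨Nat.find h, (Nat.find_spec h).1, (Nat.find_spec h).2, ?_⟩
  intro k h1 h2 h3
  exact Nat.find_min h h2 ⟨h1, h3⟩

/-- `(i, k)` is the closest label to the right of `(i, j)`. -/
def IsNextRight (f : ℕ → ℕ → Option NodeLabel) (i j k : ℕ) : Prop :=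
  j < k ∧ f i k ≠ none ∧ ∀ m, j < m → m < k → f i m = none

/-- `(k, j)` is the closest label below `(i, j)`. -/
def IsNextBelow (f : ℕ → ℕ → Option NodeLabel) (i j k : ℕ) : Prop :=
  i < k ∧ f k j ≠ none ∧ ∀ m, i < m → m < k → f m j = none

/-- `x` is `α` or `γ`. -/
def IsRow (x : NodeLabel) : Prop :=
  x = NodeLabel.lab Label.α ∨ x = NodeLabel.lab Label.γ

/-- The properties of the hooked diagram of a tableau without label `δ` and without weight `q`. -/
structure IsHooked (n : ℕ) (f : ℕ → ℕ → Option NodeLabel) : Prop where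
  outside : ∀ r c, n + 1 < r + c → f r c = none
  diagonal : ∀ r c, r + c = n + 1 → f r c ≠ none
  corner : f 0 0 = some NodeLabel.one
  row_zero : ∀ c x, f 0 c = some x → x = NodeLabel.one
  col_zero : ∀ r x, f r 0 = some x → x = NodeLabel.one
  inner : ∀ r c x, 0 < r → 0 < c → f r c = some x → x = NodeLabel.lab Label.β ∨ IsRow x
  beta_left : ∀ r c c', f r c = some (NodeLabel.lab Label.β) → c' < c → f r c' = none
  beta_above : ∀ r c, f r c = some (NodeLabel.lab Label.β) → ∃ r' < r, f r' c ≠ none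
  row_above : ∀ r c r' x, f r c = some x → IsRow x → r' < r → f r' c = none
  row_left : ∀ r c x, f r c = some x → IsRow x → ∃ c' < c, f r c' ≠ none
  no_q : ∀ r c r' c' x y, 0 < r → 0 < c → r + c ≤ n + 1 → f r c = none →
    IsNextRight f r c c' → f r c' = some x → IsRow x →
    IsNextBelow f r c r' → f r' c = some y →
    y = NodeLabel.lab Label.β ∨ y = NodeLabel.lab Label.γ → False

/-! ### Hooked diagrams of tableaux -/

section Hooked

variable {n : ℕ} (T : Tableau n)

theorem Tableau.rowIndex_eq_some (i : ℕ) (x : Label) :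
    T.rowIndex i = some x ↔ ∃ k, k < n ∧ T.label i k = some x ∧ ∀ m < k, T.label i m = none :=
  findSome?_range_eq_some _ _ _

theorem Tableau.colIndex_eq_some (j : ℕ) (x : Label) :
    T.colIndex j = some x ↔ ∃ k, k < n ∧ T.label k j = some x ∧ ∀ m < k, T.label m j = none :=
  findSome?_range_eq_some _ _ _

theorem Tableau.seesRight_eq_some (i j : ℕ) (x : Label) :
    T.seesRight i j = some x ↔
      ∃ k, k < n ∧ j < k ∧ T.label i k = some x ∧ ∀ m, j < m → m < k → T.label i m = none := by
  unfold Tableau.seesRight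
  rw [findSome?_range_eq_some]
  constructor
  · rintro ⟨k, h1, h2, h3⟩
    by_cases hk : j < k
    · refine ⟨k, h1, hk, by simpa [hk] using h2, fun m hm hmk => ?_⟩
      simpa [hm] using h3 m hmk
    · simp [hk] at h2
  · rintro ⟨k, h1, h2, h3, h4⟩
    refine ⟨k, h1, by simpa [h2] using h3, fun m hm => ?_⟩
    split_ifs with hjm
    · exact h4 m hjm hm
    · rfl

theorem Tableau.seesBelow_eq_some (i j : ℕ) (x : Label) :
    T.seesBelow i j = some x ↔
      ∃ k, k < n ∧ i < k ∧ T.label k j = some x ∧ ∀ m, i < m → m < k → T.label m j = none := by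
  unfold Tableau.seesBelow
  rw [findSome?_range_eq_some]
  constructor
  · rintro ⟨k, h1, h2, h3⟩
    by_cases hk : i < k
    · refine ⟨k, h1, hk, by simpa [hk] using h2, fun m hm hmk => ?_⟩
      simpa [hm] using h3 m hmk
    · simp [hk] at h2
  · rintro ⟨k, h1, h2, h3, h4⟩
    refine ⟨k, h1, by simpa [h2] using h3, fun m hm => ?_⟩
    split_ifs with hjm
    · exact h4 m hjm hm
    · rfl

theorem Tableau.exists_rowIndex {i : ℕ} (hi : i < n) : ∃ x, T.rowIndex i = some x := by
  classical
  have h : ∃ k, k < n ∧ T.label i k ≠ none := ⟨n - 1 - i, by omega, T.diagonal _ _ (by omega)⟩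
  obtain ⟨x, hx⟩ := Option.ne_none_iff_exists'.1 (Nat.find_spec h).2
  refine ⟨x, (T.rowIndex_eq_some i x).2 ⟨Nat.find h, (Nat.find_spec h).1, hx, fun m hm => ?_⟩⟩
  have := (Nat.find_spec h).1
  by_contra hne
  exact Nat.find_min h hm ⟨by omega, hne⟩

theorem Tableau.exists_colIndex {j : ℕ} (hj : j < n) : ∃ x, T.colIndex j = some x := by
  classical
  have h : ∃ k, k < n ∧ T.label k j ≠ none := ⟨n - 1 - j, by omega, T.diagonal _ _ (by omega)⟩
  obtain ⟨x, hx⟩ := Option.ne_none_iff_exists'.1 (Nat.find_spec h).2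
  refine ⟨x, (T.colIndex_eq_some j x).2 ⟨Nat.find h, (Nat.find_spec h).1, hx, fun m hm => ?_⟩⟩
  have := (Nat.find_spec h).1
  by_contra hne
  exact Nat.find_min h hm ⟨by omega, hne⟩

theorem Tableau.hooked_succ_succ (i j : ℕ) :
    T.hooked (i + 1) (j + 1) = (T.label i j).map NodeLabel.lab := rfl

theorem Tableau.hooked_eq_some_lab {i j : ℕ} {x : Label} :
    T.hooked (i + 1) (j + 1) = some (NodeLabel.lab x) ↔ T.label i j = some x := by
  simp [Tableau.hooked_succ_succ]

theorem Tableau.hooked_eq_none {i j : ℕ} :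
    T.hooked (i + 1) (j + 1) = none ↔ T.label i j = none := by
  simp [Tableau.hooked_succ_succ]

theorem Tableau.hooked_row_zero {c : ℕ} {x : NodeLabel} (h : T.hooked 0 c = some x) :
    x = NodeLabel.one := by
  rcases c with _ | c <;> simp only [Tableau.hooked] at h
  · simpa using h.symm
  · split_ifs at h
    simpa using h.symm

theorem Tableau.hooked_col_zero {r : ℕ} {x : NodeLabel} (h : T.hooked r 0 = some x) :
    x = NodeLabel.one := by
  rcases r with _ | r <;> simp only [Tableau.hooked] at h
  · simpa using h.symm
  · split_ifs at h
    simpa using h.symm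

theorem Tableau.hooked_lab {r c : ℕ} {x : Label} (h : T.hooked r c = some (NodeLabel.lab x)) :
    ∃ i j, r = i + 1 ∧ c = j + 1 ∧ T.label i j = some x := by
  rcases r with _ | r
  · have := T.hooked_row_zero h; simp at this
  rcases c with _ | c
  · have := T.hooked_col_zero h; simp at this
  exact ⟨r, c, rfl, rfl, T.hooked_eq_some_lab.1 h⟩

theorem Tableau.hooked_isRow {r c : ℕ} {x : NodeLabel} (h : T.hooked r c = some x)
    (hx : IsRow x) : ∃ i j y, r = i + 1 ∧ c = j + 1 ∧ T.label i j = some y ∧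
      (y = Label.α ∨ y = Label.γ) := by
  rcases hx with rfl | rfl <;> obtain ⟨i, j, h1, h2, h3⟩ := T.hooked_lab h
  · exact ⟨i, j, _, h1, h2, h3, Or.inl rfl⟩
  · exact ⟨i, j, _, h1, h2, h3, Or.inr rfl⟩

theorem Tableau.label_lt {i j : ℕ} {x : Label} (h : T.label i j = some x) : i + j < n := by
  by_contra hn
  rw [T.outside i j (by omega)] at h
  cases h

/-- The labels 1 are placed so that each β gets a label above it and each α or γ a label to its
left; their absence elsewhere extends the two emptiness rules to the hook. -/
theorem Tableau.NoDeltaNoQ.isHooked {T : Tableau n} (hT : T.NoDeltaNoQ) :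
    IsHooked n T.hooked where
  outside := by
    rintro (_ | r) (_ | c) h
    · omega
    · simp only [Tableau.hooked]
      rw [if_neg]
      rintro (h1 | h1 | h1)
      · omega
      · obtain ⟨k, -, h2, -⟩ := (T.colIndex_eq_some _ _).1 h1
        have := T.label_lt h2
        omega
      · obtain ⟨k, -, h2, -⟩ := (T.colIndex_eq_some _ _).1 h1
        have := T.label_lt h2
        omega
    · simp only [Tableau.hooked]
      rw [if_neg]
      rintro (h1 | h1 | h1)
      · omega
      · obtain ⟨k, -, h2, -⟩ := (T.rowIndex_eq_some _ _).1 h1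
        have := T.label_lt h2
        omega
      · obtain ⟨k, -, h2, -⟩ := (T.rowIndex_eq_some _ _).1 h1
        have := T.label_lt h2
        omega
    · exact T.hooked_eq_none.2 (T.outside _ _ (by omega))
  diagonal := by
    rintro (_ | r) (_ | c) h
    · omega
    · simp only [Tableau.hooked]
      rw [if_pos (Or.inl (by omega))]
      simp
    · simp only [Tableau.hooked]
      rw [if_pos (Or.inl (by omega))]
      simp
    · exact fun h' => T.diagonal r c (by omega) (T.hooked_eq_none.1 h')
  corner := rfl
  row_zero := fun _ _ h => T.hooked_row_zero h
  col_zero := fun _ _ h => T.hooked_col_zero h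
  inner := by
    rintro (_ | r) (_ | c) x hr hc h
    · omega
    · omega
    · omega
    · rw [Tableau.hooked_succ_succ] at h
      obtain ⟨y, hy, rfl⟩ := Option.map_eq_some_iff.1 h
      have := hT.1 r c
      cases y
      · exact Or.inr (Or.inl rfl)
      · exact Or.inl rfl
      · exact Or.inr (Or.inr rfl)
      · exact absurd hy this
  beta_left := by
    intro r c c' h0 hc
    obtain ⟨i, j, rfl, rfl, h⟩ := T.hooked_lab h0
    have hl := T.label_lt h
    rcases c' with _ | c'
    · have e : T.rowIndex i = some Label.β := (T.rowIndex_eq_some _ _).2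
        ⟨j, by omega, h, fun m hm => T.left_empty i j m (Or.inl h) hm⟩
      simp only [Tableau.hooked, e]
      rw [if_neg]
      rintro (h1 | h1 | h1)
      · omega
      · simp at h1
      · simp at h1
    · exact T.hooked_eq_none.2 (T.left_empty i j c' (Or.inl h) (by omega))
  beta_above := by
    intro r c h0
    obtain ⟨i, j, rfl, rfl, h⟩ := T.hooked_lab h0
    have hl := T.label_lt h
    obtain ⟨x, hx⟩ := T.exists_colIndex (j := j) (by omega)
    by_cases hb : x = Label.β
    · refine ⟨0, by omega, ?_⟩
      simp [Tableau.hooked, hx, hb]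
    · obtain ⟨k, hk, h1, h2⟩ := (T.colIndex_eq_some _ _).1 hx
      have hki : k < i := by
        rcases lt_trichotomy k i with h3 | h3 | h3
        · exact h3
        · subst h3; rw [h] at h1; exact absurd (Option.some.inj h1).symm hb
        · rw [h2 i h3] at h; cases h
      exact ⟨k + 1, by omega, fun h3 => by rw [T.hooked_eq_none.1 h3] at h1; cases h1⟩
  row_above := by
    intro r c r' x h hx hr
    obtain ⟨i, j, y, rfl, rfl, h, hy⟩ := T.hooked_isRow h hx
    have hl := T.label_lt h
    have hy' : T.label i j = some Label.α ∨ T.label i j = some Label.γ := by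
      rcases hy with rfl | rfl
      · exact Or.inl h
      · exact Or.inr h
    rcases r' with _ | r'
    · have e : T.colIndex j = some y := (T.colIndex_eq_some _ _).2
        ⟨i, by omega, h, fun m hm => T.above_empty i j m hy' hm⟩
      simp only [Tableau.hooked, e]
      rw [if_neg]
      rintro (h1 | h1 | h1)
      · omega
      · rcases hy with rfl | rfl <;> simp at h1
      · rcases hy with rfl | rfl <;> simp at h1
    · exact T.hooked_eq_none.2 (T.above_empty i j r' hy' (by omega))
  row_left := by
    intro r c x h hx
    obtain ⟨i, j, y, rfl, rfl, h, hy⟩ := T.hooked_isRow h hx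
    have hl := T.label_lt h
    obtain ⟨z, hz⟩ := T.exists_rowIndex (i := i) (by omega)
    by_cases hb : z = Label.α ∨ z = Label.γ
    · refine ⟨0, by omega, ?_⟩
      simp [Tableau.hooked, hz, hb]
    · obtain ⟨k, hk, h1, h2⟩ := (T.rowIndex_eq_some _ _).1 hz
      have hki : k < j := by
        rcases lt_trichotomy k j with h3 | h3 | h3
        · exact h3
        · subst h3; rw [h] at h1; cases h1; exact absurd hy hb
        · rw [h2 j h3] at h; cases h
      exact ⟨k + 1, by omega, fun h3 => by rw [T.hooked_eq_none.1 h3] at h1; cases h1⟩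
  no_q := by
    intro r c r' c' x y hr hc hrc h0 hR hx hxr hB hy hyb
    obtain ⟨i, j', z, rfl, rfl, hz, hz'⟩ := T.hooked_isRow hx hxr
    obtain ⟨j, rfl⟩ : ∃ j, c = j + 1 := ⟨c - 1, by omega⟩
    obtain ⟨i', w, rfl, hw, hw'⟩ : ∃ i' w, r' = i' + 1 ∧ T.label i' j = some w ∧
        (w = Label.β ∨ w = Label.γ) := by
      rcases hyb with rfl | rfl <;> obtain ⟨i', _, h1, h2, h3⟩ := T.hooked_lab hy <;> cases h2
      · exact ⟨i', _, h1, h3, Or.inl rfl⟩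
      · exact ⟨i', _, h1, h3, Or.inr rfl⟩
    have hl := T.label_lt hz
    have hl' := T.label_lt hw
    have e1 : T.seesRight i j = some z := (T.seesRight_eq_some _ _ _).2
      ⟨j', by omega, by have := hR.1; omega, hz, fun m h1 h2 =>
        T.hooked_eq_none.1 (hR.2.2 (m + 1) (by omega) (by omega))⟩
    have e2 : T.seesBelow i j = some w := (T.seesBelow_eq_some _ _ _).2
      ⟨i', by omega, by have := hB.1; omega, hw, fun m h1 h2 =>
        T.hooked_eq_none.1 (hB.2.2 (m + 1) (by omega) (by omega))⟩
    refine hT.2 i j ⟨by omega, T.hooked_eq_none.1 h0, Or.inr ⟨?_, ?_⟩⟩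
    · rw [e1]; rcases hz' with rfl | rfl <;> simp
    · rw [e2]; rcases hw' with rfl | rfl <;> simp

end Hooked

/-! The sons of a label -/

section Sons

variable {n : ℕ} {f : ℕ → ℕ → Option NodeLabel}

theorem IsHooked.exists_nextRight (hf : IsHooked n f) {i j : ℕ} (h : i + j ≤ n) :
    ∃ k, IsNextRight f i j k := by
  obtain ⟨k, h1, h2, h3⟩ := exists_first_gt (P := fun k => f i k ≠ none) (r := j)
    ⟨n + 1 - i, by omega, hf.diagonal _ _ (by omega)⟩
  exact ⟨k, h1, h2, fun m hm hmk => not_not.1 (h3 m hm hmk)⟩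

theorem IsHooked.exists_nextBelow (hf : IsHooked n f) {i j : ℕ} (h : i + j ≤ n) :
    ∃ k, IsNextBelow f i j k := by
  obtain ⟨k, h1, h2, h3⟩ := exists_first_gt (P := fun k => f k j ≠ none) (r := i)
    ⟨n + 1 - j, by omega, hf.diagonal _ _ (by omega)⟩
  exact ⟨k, h1, h2, fun m hm hmk => not_not.1 (h3 m hm hmk)⟩

theorem IsHooked.le_of_ne_none (hf : IsHooked n f) {r c : ℕ} (h : f r c ≠ none) :
    r + c ≤ n + 1 := by
  by_contra hn
  exact h (hf.outside r c (by omega))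

theorem IsHooked.right_son (hf : IsHooked n f) {i j k : ℕ} (h0 : f i j ≠ none)
    (h : IsNextRight f i j k) (hi : 0 < i) : ∃ x, f i k = some x ∧ IsRow x := by
  obtain ⟨x, hx⟩ := Option.ne_none_iff_exists'.1 h.2.1
  rcases hf.inner i k x hi (by have := h.1; omega) hx with rfl | hr
  · exact absurd (hf.beta_left i k j hx h.1) h0
  · exact ⟨x, hx, hr⟩

theorem IsHooked.left_son (hf : IsHooked n f) {i j k : ℕ} (h0 : f i j ≠ none)
    (h : IsNextBelow f i j k) (hj : 0 < j) : f k j = some (NodeLabel.lab Label.β) := by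
  obtain ⟨x, hx⟩ := Option.ne_none_iff_exists'.1 h.2.1
  rcases hf.inner k j x (by have := h.1; omega) hj hx with rfl | hr
  · exact hx
  · exact absurd (hf.row_above k j i x hx hr h.1) h0

/-- There is no label between the left and the right subtree of a label. -/
theorem IsHooked.rectangle (hf : IsHooked n f) {i j i' j' : ℕ} (h0 : f i j ≠ none)
    (hB : IsNextBelow f i j i') (hR : IsNextRight f i j j') :
    ∀ m r c, r + c ≤ m → i < r → r < i' → j < c → c < j' → f r c = none := by
  intro m
  induction m with
  | zero => intros; omega
  | succ m ih =>
    intro r c hm h1 h2 h3 h4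
    by_contra hne
    have hrc := hf.le_of_ne_none hne
    obtain ⟨x, hx⟩ := Option.ne_none_iff_exists'.1 hne
    rcases hf.inner r c x (by omega) (by omega) hx with rfl | hr
    · obtain ⟨k, hk, hk1, hk2⟩ := exists_last_lt (hf.beta_above r c hx)
      rcases lt_trichotomy k i with h5 | h5 | h5
      · obtain ⟨y, hy, hyr⟩ := hf.right_son h0 hR (by omega)
        exact hf.no_q i c r j' y _ (by omega) (by omega) (by omega) (hR.2.2 c h3 h4)
          ⟨h4, hR.2.1, fun l h6 h7 => hR.2.2 l (by omega) h7⟩ hy hyr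
          ⟨h1, hne, fun l h6 h7 => not_not.1 (hk2 l (by omega) h7)⟩ hx (Or.inl rfl)
      · subst h5
        exact hk1 (hR.2.2 c h3 h4)
      · exact hk1 (ih k c (by omega) h5 (by omega) h3 h4)
    -- Symmetrically for an α or γ: the blank box (r, j) would see it to the right and the left son
    -- β below.
    · obtain ⟨k, hk, hk1, hk2⟩ := exists_last_lt (hf.row_left r c x hx hr)
      rcases lt_trichotomy k j with h5 | h5 | h5
      · exact hf.no_q r j i' c x _ (by omega) (by omega) (by omega) (hB.2.2 r h1 h2)
          ⟨h3, hne, fun l h6 h7 => not_not.1 (hk2 l (by omega) h7)⟩ hx hr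
          ⟨h2, hB.2.1, fun l h6 h7 => hB.2.2 l (by omega) h7⟩
          (hf.left_son h0 hB (by omega)) (Or.inl rfl)
      · subst h5
        exact hk1 (hB.2.2 r h1 h2)
      · exact hk1 (ih r k (by omega) h1 h2 h5 (by omega))

/-- The diagonal labels of the left subtree and of the right subtree of a label are adjacent. -/
theorem IsHooked.sons_add (hf : IsHooked n f) {i j i' j' : ℕ} (h0 : f i j ≠ none)
    (hB : IsNextBelow f i j i') (hR : IsNextRight f i j j') : i' + j' = n + 2 := by
  have hi := hB.1
  have hj := hR.1
  have hR' := hf.le_of_ne_none hR.2.1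
  have hB' := hf.le_of_ne_none hB.2.1
  rcases lt_trichotomy (i' + j') (n + 2) with h | h | h
  -- If the sons are too close, box (i', j') is blank and off the diagonal; the two sons force an α
  -- or γ to its right and a β below it, hence a weight q.
  · exfalso
    have hnone : f i' j' = none := by
      by_contra hne
      obtain ⟨x, hx⟩ := Option.ne_none_iff_exists'.1 hne
      rcases hf.inner i' j' x (by omega) (by omega) hx with rfl | hr
      · exact hB.2.1 (hf.beta_left i' j' j hx hj)
      · exact hR.2.1 (hf.row_above i' j' i x hx hr hi)
    have hlt : i' + j' ≤ n := by
      by_contra hlt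
      exact hf.diagonal i' j' (by omega) hnone
    obtain ⟨c, hc⟩ := hf.exists_nextRight hlt
    obtain ⟨r, hr⟩ := hf.exists_nextBelow hlt
    have hc1 := hc.1
    have hr1 := hr.1
    obtain ⟨x, hx⟩ := Option.ne_none_iff_exists'.1 hc.2.1
    obtain ⟨y, hy⟩ := Option.ne_none_iff_exists'.1 hr.2.1
    have hx' : IsRow x := by
      rcases hf.inner i' c x (by omega) (by omega) hx with rfl | h1
      · exact absurd (hf.beta_left i' c j hx (by omega)) hB.2.1
      · exact h1
    have hy' : y = NodeLabel.lab Label.β := by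
      rcases hf.inner r j' y (by omega) (by omega) hy with h1 | h1
      · exact h1
      · exact absurd (hf.row_above r j' i y hy h1 (by omega)) hR.2.1
    exact hf.no_q i' j' r c x y (by omega) (by omega) (by omega) hnone hc hx hx' hr hy
      (Or.inl hy')
  · exact h
  -- If they are too far apart, the diagonal box in column j' - 1 falls into the empty rectangle, or
  -- into column j strictly above the left son.
  · exfalso
    have hd := hf.diagonal (n + 2 - j') (j' - 1) (by omega)
    rcases Nat.lt_or_ge j (j' - 1) with h1 | h1
    · exact hd (hf.rectangle h0 hB hR _ _ _ le_rfl (by omega) (by omega) h1 (by omega))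
    · have : j' - 1 = j := by omega
      rw [this] at hd
      exact hd (hB.2.2 _ (by omega) (by omega))

end Sons

/-! The tree determines the tableau -/

/-- The label of a left son in column `j`. -/
def leftLabel (j : ℕ) : NodeLabel :=
  if j = 0 then NodeLabel.one else NodeLabel.lab Label.β

/-- The labels of the tree `t`, whose root is labeled `x` and placed in box `(i, j)`. -/
def paint : NodeLabel → BinaryTree NodeLabel → ℕ → ℕ → ℕ → ℕ → Option NodeLabel
  | x, nil, i, j, r, c => if r = i ∧ c = j then some x else none
  | x, node y a b, i, j, r, c =>
    if r = i ∧ c = j then some x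
    -- The right subtree uses the rows i to i + |b| and the left subtree the columns j to j + |a|;
    -- each son comes just after the other's range.
    else if i + b.numNodes < r then paint (leftLabel j) a (i + b.numNodes + 1) j r c
    else if j + a.numNodes < c then paint y b i (j + a.numNodes + 1) r c
    else none

section TreeAt

variable {n : ℕ} {T : Tableau n}

theorem Tableau.nextRight_eq_some (hf : IsHooked n T.hooked) (i j k : ℕ) :
    T.nextRight i j = some k ↔ IsNextRight T.hooked i j k := by
  unfold Tableau.nextRight
  rw [List.find?_range_eq_some]
  constructor
  · rintro ⟨h1, h2, h3⟩
    simp only [Bool.and_eq_true, decide_eq_true_eq, Option.isSome_iff_ne_none] at h1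
    refine ⟨h1.1, h1.2, fun m hm hmk => ?_⟩
    have := h3 m hmk
    simpa [hm] using this
  · rintro ⟨h1, h2, h3⟩
    have := hf.le_of_ne_none h2
    refine ⟨by simpa [h1, Option.isSome_iff_ne_none] using h2, by simp; omega, fun m hm => ?_⟩
    by_cases hjm : j < m
    · simp [h3 m hjm hm]
    · simp [hjm]

theorem Tableau.nextBelow_eq_some (hf : IsHooked n T.hooked) (i j k : ℕ) :
    T.nextBelow i j = some k ↔ IsNextBelow T.hooked i j k := by
  unfold Tableau.nextBelow
  rw [List.find?_range_eq_some]
  constructor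
  · rintro ⟨h1, h2, h3⟩
    simp only [Bool.and_eq_true, decide_eq_true_eq, Option.isSome_iff_ne_none] at h1
    refine ⟨h1.1, h1.2, fun m hm hmk => ?_⟩
    have := h3 m hmk
    simpa [hm] using this
  · rintro ⟨h1, h2, h3⟩
    have := hf.le_of_ne_none h2
    refine ⟨by simpa [h1, Option.isSome_iff_ne_none] using h2, by simp; omega, fun m hm => ?_⟩
    by_cases hjm : i < m
    · simp [h3 m hjm hm]
    · simp [hjm]

theorem Tableau.treeAt_cases (hf : IsHooked n T.hooked) {d i j : ℕ} (h0 : T.hooked i j ≠ none)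
    (hd : n + 1 ≤ d + i + j) :
    (i + j = n + 1 ∧ T.treeAt d i j = nil) ∨
      ∃ d' i' j' x, d = d' + 1 ∧ i + j ≤ n ∧ IsNextBelow T.hooked i j i' ∧
        IsNextRight T.hooked i j j' ∧ i' + j' = n + 2 ∧ T.hooked i j' = some x ∧
        T.treeAt d i j = node x (T.treeAt d' i' j) (T.treeAt d' i j') := by
  have hij := hf.le_of_ne_none h0
  rcases Nat.lt_or_ge n (i + j) with h | h
  · refine Or.inl ⟨by omega, ?_⟩
    cases d with
    | zero => rfl
    | succ d =>
      have : T.nextRight i j = none := by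
        rw [Option.eq_none_iff_forall_ne_some]
        intro k hk
        have hk' := (T.nextRight_eq_some hf i j k).1 hk
        have := hf.le_of_ne_none hk'.2.1
        have := hk'.1
        omega
      rw [Tableau.treeAt, this]
      cases T.nextBelow i j <;> rfl
  · right
    obtain ⟨j', hR⟩ := hf.exists_nextRight h
    obtain ⟨i', hB⟩ := hf.exists_nextBelow h
    obtain ⟨x, hx⟩ := Option.ne_none_iff_exists'.1 hR.2.1
    obtain ⟨d', rfl⟩ : ∃ d', d = d' + 1 := ⟨d - 1, by omega⟩
    refine ⟨d', i', j', x, rfl, h, hB, hR, hf.sons_add h0 hB hR, hx, ?_⟩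
    rw [Tableau.treeAt, (T.nextRight_eq_some hf i j j').2 hR,
      (T.nextBelow_eq_some hf i j i').2 hB]
    simp [hx]

/-- The subtree at (i, j) fills the diagonal to the right of column j and below row i, which fixes
its size; with `IsHooked.sons_add` the sizes then give the positions of both sons. -/
theorem Tableau.hooked_eq_paint_treeAt (hf : IsHooked n T.hooked) :
    ∀ d i j x, T.hooked i j = some x → n + 1 ≤ d + i + j →
      (T.treeAt d i j).numNodes + i + j = n + 1 ∧
        ∀ r c, i ≤ r → j ≤ c → T.hooked r c = paint x (T.treeAt d i j) i j r c := by
  have base (d i j x) (hx : T.hooked i j = some x) (h : i + j = n + 1)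
      (ht : T.treeAt d i j = nil) :
      (T.treeAt d i j).numNodes + i + j = n + 1 ∧
        ∀ r c, i ≤ r → j ≤ c → T.hooked r c = paint x (T.treeAt d i j) i j r c := by
    rw [ht]
    refine ⟨by simp [h], fun r c hr hc => ?_⟩
    rw [paint]
    split_ifs with h1
    · rw [h1.1, h1.2, hx]
    · exact hf.outside r c (by omega)
  intro d
  induction d with
  | zero =>
    intro i j x hx hd
    have := hf.le_of_ne_none (r := i) (c := j) (by simp [hx])
    exact base 0 i j x hx (by omega) rfl
  | succ d ih =>
    intro i j x hx hd
    have h0 : T.hooked i j ≠ none := by simp [hx]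
    rcases T.treeAt_cases hf h0 hd with ⟨h1, h2⟩ | ⟨d', i', j', y, hd', h1, hB, hR, h2, hy, ht⟩
    · exact base _ i j x hx h1 h2
    · obtain rfl : d = d' := by omega
      have hi := hB.1
      have hj := hR.1
      obtain ⟨z, hz⟩ := Option.ne_none_iff_exists'.1 hB.2.1
      have hz' : z = leftLabel j := by
        rcases Nat.eq_zero_or_pos j with hj0 | hj0
        · subst hj0
          exact hf.col_zero _ _ hz
        · have := hf.left_son h0 hB hj0
          rw [hz] at this
          simp only [Option.some.injEq] at this
          rw [this, leftLabel, if_neg (by omega)]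
      subst hz'
      obtain ⟨ha, ha'⟩ := ih i' j _ hz (by omega)
      obtain ⟨hb, hb'⟩ := ih i j' y hy (by omega)
      rw [ht]
      refine ⟨by rw [BinaryTree.numNodes]; omega, fun r c hr hc => ?_⟩
      have e1 : i + (T.treeAt d i j').numNodes + 1 = i' := by omega
      have e2 : j + (T.treeAt d i' j).numNodes + 1 = j' := by omega
      rw [paint, e1, e2]
      split_ifs with h3 h4 h5
      · rw [h3.1, h3.2, hx]
      · exact ha' r c (by omega) hc
      · exact hb' r c hr (by omega)
      · rcases Nat.eq_or_lt_of_le hr with h6 | h6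
        · subst h6
          exact hR.2.2 c (by omega) (by omega)
        · rcases Nat.eq_or_lt_of_le hc with h7 | h7
          · subst h7
            exact hB.2.2 r h6 (by omega)
          · exact hf.rectangle h0 hB hR _ r c le_rfl h6 (by omega) h7 (by omega)

theorem Tableau.hooked_eq_paint (hf : IsHooked n T.hooked) :
    T.tree.numNodes = n + 1 ∧ T.hooked = paint NodeLabel.one T.tree 0 0 := by
  obtain ⟨h1, h2⟩ := T.hooked_eq_paint_treeAt hf (n + 1) 0 0 _ hf.corner (by omega)
  exact ⟨h1, funext fun r => funext fun c => h2 r c (Nat.zero_le _) (Nat.zero_le _)⟩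

theorem Tableau.allAlpha_treeAt (hf : IsHooked n T.hooked) :
    ∀ d i j, T.hooked i j ≠ none → 0 < i → n + 1 ≤ d + i + j →
      (∀ r c, i ≤ r → j < c → T.hooked r c ≠ some (NodeLabel.lab Label.γ)) →
      AllAlpha (T.treeAt d i j) := by
  intro d
  induction d with
  | zero => intros; trivial
  | succ d ih =>
    intro i j h0 hi hd hγ
    rcases T.treeAt_cases hf h0 hd with ⟨h1, h2⟩ | ⟨d', i', j', y, hd', h1, hB, hR, h2, hy, ht⟩
    · rw [h2]; trivial
    · obtain rfl : d = d' := by omega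
      have hi' := hB.1
      have hj' := hR.1
      rw [ht]
      refine ⟨?_, ih i' j hB.2.1 (by omega) (by omega) fun r c hr hc => hγ r c (by omega) hc,
        ih i j' hR.2.1 hi (by omega) fun r c hr hc => hγ r c hr (by omega)⟩
      obtain ⟨x, hx, hr⟩ := hf.right_son h0 hR hi
      rw [hy] at hx
      cases hx
      rcases hr with rfl | rfl
      · rfl
      · exact absurd hy (hγ i j' le_rfl hj')

theorem Tableau.sideAdmissible_treeAt (hf : IsHooked n T.hooked) :
    ∀ d i j, T.hooked i j ≠ none → 0 < i → n + 1 ≤ d + i + j →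
      SideAdmissible (T.treeAt d i j) := by
  intro d
  induction d with
  | zero => intros; trivial
  | succ d ih =>
    intro i j h0 hi hd
    rcases T.treeAt_cases hf h0 hd with ⟨h1, h2⟩ | ⟨d', i', j', y, hd', h1, hB, hR, h2, hy, ht⟩
    · rw [h2]; trivial
    · obtain rfl : d = d' := by omega
      have hi' := hB.1
      have hj' := hR.1
      obtain ⟨x, hx, hr⟩ := hf.right_son h0 hR hi
      rw [hy] at hx
      cases hx
      rw [ht]
      refine ⟨hr, T.allAlpha_treeAt hf d i' j hB.2.1 (by omega) (by omega) ?_,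
        ih i j' hR.2.1 hi (by omega)⟩
      -- A γ in the left subtree lies in a column between the label and its right son, so the blank
      -- box above it in row i would see the right son and this γ: a weight q.
      intro r c hr' hc hγ
      have hrc := hf.le_of_ne_none (r := r) (c := c) (by simp [hγ])
      exact hf.no_q i c r j' y _ hi (by omega) (by omega) (hR.2.2 c hc (by omega))
        ⟨by omega, hR.2.1, fun m h3 h4 => hR.2.2 m (by omega) h4⟩ hy hr
        ⟨by omega, by simp [hγ], fun m h3 h4 => hf.row_above r c m _ hγ (Or.inr rfl) h4⟩ hγ
        (Or.inr rfl)

theorem Tableau.admissible_treeAt (hf : IsHooked n T.hooked) :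
    ∀ d j, T.hooked 0 j ≠ none → n + 1 ≤ d + j → Admissible (T.treeAt d 0 j) := by
  intro d
  induction d with
  | zero => intros; trivial
  | succ d ih =>
    intro j h0 hd
    rcases T.treeAt_cases hf h0 hd with ⟨h1, h2⟩ | ⟨d', i', j', y, hd', h1, hB, hR, h2, hy, ht⟩
    · rw [h2]; trivial
    · obtain rfl : d = d' := by omega
      have hi' := hB.1
      have hj' := hR.1
      rw [ht]
      exact ⟨hf.row_zero _ _ hy, T.sideAdmissible_treeAt hf d i' j hB.2.1 hi' (by omega),
        ih j' hR.2.1 (by omega)⟩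

theorem Tableau.admissible_tree (hf : IsHooked n T.hooked) : Admissible T.tree :=
  T.admissible_treeAt hf (n + 1) 0 (by simp [hf.corner]) (by omega)

theorem Tableau.eq_of_hooked_eq {S T : Tableau n} (h : S.hooked = T.hooked) : S = T := by
  ext i j x
  rw [← S.hooked_eq_some_lab, ← T.hooked_eq_some_lab, h]

end TreeAt

/-! Painting a tree -/

theorem paint_root (x : NodeLabel) (s : BinaryTree NodeLabel) (i j : ℕ) :
    paint x s i j i j = some x := by
  cases s <;> simp [paint]

theorem paint_support {s : BinaryTree NodeLabel} : ∀ {x i j r c}, paint x s i j r c ≠ none →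
    i ≤ r ∧ j ≤ c ∧ r + c ≤ i + j + s.numNodes := by
  induction s with
  | nil =>
    intro x i j r c h
    rw [paint] at h
    split_ifs at h with h1
    · simp [h1.1, h1.2]
    · exact absurd rfl h
  | node y a b iha ihb =>
    intro x i j r c h
    rw [paint] at h
    rw [BinaryTree.numNodes]
    split_ifs at h with h1 h2 h3
    · omega
    · have := iha h; omega
    · have := ihb h; omega
    · exact absurd rfl h

theorem paint_eq_none {x : NodeLabel} {s : BinaryTree NodeLabel} {i j r c : ℕ}
    (h : r < i ∨ c < j ∨ i + j + s.numNodes < r + c) : paint x s i j r c = none := by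
  by_contra hne
  have := paint_support hne
  omega

theorem paint_diagonal {s : BinaryTree NodeLabel} : ∀ {x i j r c}, i ≤ r → j ≤ c →
    r + c = i + j + s.numNodes → paint x s i j r c ≠ none := by
  induction s with
  | nil =>
    intro x i j r c h1 h2 h3
    rw [BinaryTree.numNodes] at h3
    rw [paint, if_pos (by omega)]
    simp
  | node y a b iha ihb =>
    intro x i j r c h1 h2 h3
    rw [BinaryTree.numNodes] at h3
    rw [paint]
    split_ifs with h4 h5 h6
    · simp
    · exact iha (by omega) h2 (by omega)
    · exact ihb h1 (by omega) (by omega)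
    · omega

/-! Three regions of a painted node -/

section Regions

variable {x y : NodeLabel} {a b : BinaryTree NodeLabel} {i j r c : ℕ}

theorem paint_left (h : i + b.numNodes < r) :
    paint x (node y a b) i j r c = paint (leftLabel j) a (i + b.numNodes + 1) j r c := by
  rw [paint, if_neg (by omega), if_pos h]

theorem paint_right (h : r ≤ i + b.numNodes) (hc : j + a.numNodes < c) :
    paint x (node y a b) i j r c = paint y b i (j + a.numNodes + 1) r c := by
  rw [paint, if_neg (by omega), if_neg (by omega), if_pos hc]

theorem paint_middle (h : r ≤ i + b.numNodes) (hc : c ≤ j + a.numNodes)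
    (hne : ¬ (r = i ∧ c = j)) : paint x (node y a b) i j r c = none := by
  rw [paint, if_neg hne, if_neg (by omega), if_neg (by omega)]

end Regions

/-- The next label in the row of the root shows the size of the left subtree by its position, and
the label of the node by its content. -/
theorem paint_inj {s : BinaryTree NodeLabel} : ∀ {t : BinaryTree NodeLabel} {x x' i j},
    s.numNodes = t.numNodes →
    (∀ r c, i ≤ r → j ≤ c → paint x s i j r c = paint x' t i j r c) → s = t := by
  induction s with
  | nil =>
    intro t x x' i j h _
    cases t with
    | nil => rfl
    | node y a b => simp at h
  | node y a b iha ihb =>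
    intro t x x' i j h hst
    cases t with
    | nil => simp at h
    | node y' a' b' =>
      simp only [BinaryTree.numNodes] at h
      have ha : a.numNodes = a'.numNodes := by
        rcases lt_trichotomy a.numNodes a'.numNodes with h1 | h1 | h1
        · have e := hst i (j + a.numNodes + 1) le_rfl (by omega)
          rw [paint_right (by omega) (by omega), paint_root,
            paint_middle (by omega) (by omega) (by omega)] at e
          cases e
        · exact h1
        · have e := hst i (j + a'.numNodes + 1) le_rfl (by omega)
          rw [paint_right (a := a') (by omega) (by omega), paint_root,
            paint_middle (by omega) (by omega) (by omega)] at e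
          cases e
      have hb : b.numNodes = b'.numNodes := by omega
      have e1 : a = a' := by
        refine iha (x := leftLabel j) (x' := leftLabel j) (i := i + b.numNodes + 1) (j := j) ha ?_
        intro r c hr hc
        have e := hst r c (by omega) hc
        rwa [paint_left (by omega), paint_left (by omega), ← hb] at e
      have e2 : b = b' := by
        refine ihb (x := y) (x' := y') (i := i) (j := j + a.numNodes + 1) hb ?_
        intro r c hr hc
        rcases Nat.lt_or_ge (i + b.numNodes) r with h1 | h1
        · rw [paint_eq_none (by omega), paint_eq_none (by omega)]
        · have e := hst r c hr (by omega)
          rwa [paint_right h1 (by omega), paint_right (by omega) (by omega), ← ha] at e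
      subst e1 e2
      have e := hst i (j + a.numNodes + 1) le_rfl (by omega)
      rw [paint_right (by omega) (by omega), paint_right (by omega) (by omega), paint_root,
        paint_root] at e
      rw [Option.some.inj e]

/-! ### Where the labels of a painted tree lie -/

/-- No node carries `β`. -/
def NoBeta : BinaryTree NodeLabel → Prop
  | nil => True
  | node x l r => x ≠ NodeLabel.lab Label.β ∧ NoBeta l ∧ NoBeta r

theorem AllAlpha.noBeta {t : BinaryTree NodeLabel} (h : AllAlpha t) : NoBeta t := by
  induction t with
  | nil => trivial
  | node x l r ihl ihr => exact ⟨by simp [h.1], ihl h.2.1, ihr h.2.2⟩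

theorem SideAdmissible.noBeta {t : BinaryTree NodeLabel} (h : SideAdmissible t) : NoBeta t := by
  induction t with
  | nil => trivial
  | node x l r _ ihr =>
    exact ⟨by rcases h.1 with h | h <;> simp [h], h.2.1.noBeta, ihr h.2.2⟩

theorem Admissible.noBeta {t : BinaryTree NodeLabel} (h : Admissible t) : NoBeta t := by
  induction t with
  | nil => trivial
  | node x l r _ ihr => exact ⟨by simp [h.1], h.2.1.noBeta, ihr h.2.2⟩

theorem not_isRow_leftLabel (j : ℕ) : ¬ IsRow (leftLabel j) := by
  unfold leftLabel IsRow
  split_ifs <;> simp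

/-- Apart from the root, a β is a left son: its father is above it and it opens its row. -/
theorem paint_beta {s : BinaryTree NodeLabel} : ∀ {x i j r c}, NoBeta s →
    paint x s i j r c = some (NodeLabel.lab Label.β) → ¬ (r = i ∧ c = j) →
    (∀ c' < c, paint x s i j r c' = none) ∧ ∃ r' < r, paint x s i j r' c ≠ none := by
  induction s with
  | nil =>
    intro x i j r c _ h hne
    rw [paint, if_neg hne] at h
    cases h
  | node y a b iha ihb =>
    intro x i j r c hs h hne
    have hsup := paint_support (by rw [h]; simp : paint x (node y a b) i j r c ≠ none)
    rcases Nat.lt_or_ge (i + b.numNodes) r with h1 | h1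
    · rw [paint_left h1] at h
      by_cases h2 : r = i + b.numNodes + 1 ∧ c = j
      · refine ⟨fun c' hc' => paint_eq_none (by omega), i, by omega, ?_⟩
        rw [h2.2, paint_root]
        simp
      · obtain ⟨e1, r', e2, e3⟩ := iha hs.2.1 h h2
        refine ⟨fun c' hc' => ?_, r', e2, ?_⟩
        · rw [paint_left h1, e1 c' hc']
        · rwa [paint_left (by have := paint_support e3; omega)]
    · rcases Nat.lt_or_ge (j + a.numNodes) c with h2 | h2
      · rw [paint_right h1 h2] at h
        by_cases h3 : r = i ∧ c = j + a.numNodes + 1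
        · rw [h3.1, h3.2, paint_root] at h
          exact absurd (Option.some.inj h) hs.1
        · obtain ⟨e1, r', e2, e3⟩ := ihb hs.2.2 h h3
          -- In row i the right son would stand to the left of this β.
          have hr : r ≠ i := by
            rintro rfl
            have h4 := e1 (j + a.numNodes + 1) (by omega)
            rw [paint_root] at h4
            cases h4
          refine ⟨fun c' hc' => ?_, r', e2, ?_⟩
          · rcases Nat.lt_or_ge (j + a.numNodes) c' with h4 | h4
            · rw [paint_right h1 h4, e1 c' hc']
            · exact paint_middle h1 h4 (by omega)
          · rwa [paint_right (by omega) h2]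
      · rw [paint_middle h1 h2 hne] at h
        cases h

/-- Mirror image of `paint_beta`: such a label is a right son, with its father to its left and
nothing above it. -/
theorem paint_row {s : BinaryTree NodeLabel} : ∀ {x z i j r c},
    paint x s i j r c = some z → IsRow z → ¬ (r = i ∧ c = j) →
    (∀ r' < r, paint x s i j r' c = none) ∧ ∃ c' < c, paint x s i j r c' ≠ none := by
  induction s with
  | nil =>
    intro x z i j r c h _ hne
    rw [paint, if_neg hne] at h
    cases h
  | node y a b iha ihb =>
    intro x z i j r c h hz hne
    have hsup := paint_support (by rw [h]; simp : paint x (node y a b) i j r c ≠ none)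
    rcases Nat.lt_or_ge (i + b.numNodes) r with h1 | h1
    · rw [paint_left h1] at h
      by_cases h2 : r = i + b.numNodes + 1 ∧ c = j
      · rw [h2.1, h2.2, paint_root] at h
        cases h
        exact absurd hz (not_isRow_leftLabel j)
      · obtain ⟨e1, c', e2, e3⟩ := iha h hz h2
        have hsup' := paint_support
          (by rw [h]; simp : paint (leftLabel j) a (i + b.numNodes + 1) j r c ≠ none)
        have hc : c ≠ j := by
          rintro rfl
          have h4 := e1 (i + b.numNodes + 1) (by omega)
          rw [paint_root] at h4
          cases h4
        refine ⟨fun r' hr' => ?_, c', e2, ?_⟩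
        · rcases Nat.lt_or_ge (i + b.numNodes) r' with h4 | h4
          · rw [paint_left h4, e1 r' hr']
          · exact paint_middle h4 (by omega) (by omega)
        · rwa [paint_left h1]
    · rcases Nat.lt_or_ge (j + a.numNodes) c with h2 | h2
      · rw [paint_right h1 h2] at h
        by_cases h3 : r = i ∧ c = j + a.numNodes + 1
        · refine ⟨fun r' hr' => paint_eq_none (by omega), j, by omega, ?_⟩
          rw [h3.1, paint_root]
          simp
        · obtain ⟨e1, c', e2, e3⟩ := ihb h hz h3
          refine ⟨fun r' hr' => ?_, c', e2, ?_⟩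
          · rw [paint_right (by omega) h2, e1 r' hr']
          · rwa [paint_right h1 (by have := paint_support e3; omega)]
      · rw [paint_middle h1 h2 hne] at h
        cases h

theorem SideAdmissible.paint_label {s : BinaryTree NodeLabel} : ∀ {x z i j r c},
    SideAdmissible s → paint x s i j r c = some z → ¬ (r = i ∧ c = j) →
    (i < r ∧ z = leftLabel c) ∨ (j < c ∧ IsRow z) := by
  induction s with
  | nil =>
    intro x z i j r c _ h hne
    rw [paint, if_neg hne] at h
    cases h
  | node y a b iha ihb =>
    intro x z i j r c hs h hne
    rcases Nat.lt_or_ge (i + b.numNodes) r with h1 | h1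
    · rw [paint_left h1] at h
      by_cases h2 : r = i + b.numNodes + 1 ∧ c = j
      · rw [h2.1, h2.2, paint_root] at h
        rw [h2.2]
        exact Or.inl ⟨by omega, (Option.some.inj h).symm⟩
      · rcases iha hs.2.1.sideAdmissible h h2 with h3 | h3
        · exact Or.inl ⟨by omega, h3.2⟩
        · exact Or.inr h3
    · rcases Nat.lt_or_ge (j + a.numNodes) c with h2 | h2
      · rw [paint_right h1 h2] at h
        by_cases h3 : r = i ∧ c = j + a.numNodes + 1
        · rw [h3.1, h3.2, paint_root] at h
          cases h
          exact Or.inr ⟨by omega, hs.1⟩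
        · rcases ihb hs.2.2 h h3 with h4 | h4
          · exact Or.inl h4
          · exact Or.inr ⟨by omega, h4.2⟩
      · rw [paint_middle h1 h2 hne] at h
        cases h

theorem Admissible.paint_label {s : BinaryTree NodeLabel} : ∀ {x z j r c},
    Admissible s → paint x s 0 j r c = some z → ¬ (r = 0 ∧ c = j) →
    (0 < r ∧ z = leftLabel c) ∨ (0 < r ∧ 0 < c ∧ IsRow z) ∨ (r = 0 ∧ z = NodeLabel.one) := by
  induction s with
  | nil =>
    intro x z j r c _ h hne
    rw [paint, if_neg hne] at h
    cases h
  | node y a b iha ihb =>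
    intro x z j r c hs h hne
    rcases Nat.lt_or_ge (0 + b.numNodes) r with h1 | h1
    · rw [paint_left h1] at h
      by_cases h2 : r = 0 + b.numNodes + 1 ∧ c = j
      · rw [h2.1, h2.2, paint_root] at h
        rw [h2.2]
        exact Or.inl ⟨by omega, (Option.some.inj h).symm⟩
      · rcases hs.2.1.paint_label h h2 with h3 | h3
        · exact Or.inl ⟨by omega, h3.2⟩
        · exact Or.inr (Or.inl ⟨by omega, by omega, h3.2⟩)
    · rcases Nat.lt_or_ge (j + a.numNodes) c with h2 | h2
      · rw [paint_right h1 h2] at h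
        by_cases h3 : r = 0 ∧ c = j + a.numNodes + 1
        · rw [h3.1, h3.2, paint_root] at h
          cases h
          exact Or.inr (Or.inr ⟨h3.1, hs.1⟩)
        · exact ihb hs.2.2 h h3
      · rw [paint_middle h1 h2 hne] at h
        cases h

/-- The left-most label of a row below the row of the root is `β`. -/
theorem paint_first_in_row {s : BinaryTree NodeLabel} : ∀ {x i j r}, 0 < j → i < r →
    r ≤ i + s.numNodes → ∃ k, paint x s i j r k = some (NodeLabel.lab Label.β) ∧
      ∀ m < k, paint x s i j r m = none := by
  induction s with
  | nil => intro x i j r _ h1 h2; simp at h2; omega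
  | node y a b iha ihb =>
    intro x i j r hj h1 h2
    rw [BinaryTree.numNodes] at h2
    rcases Nat.lt_or_ge (i + b.numNodes) r with h3 | h3
    · rcases Nat.eq_or_lt_of_le (show i + b.numNodes + 1 ≤ r from h3) with h4 | h4
      · refine ⟨j, ?_, fun m hm => paint_eq_none (by omega)⟩
        rw [paint_left h3, ← h4, paint_root, leftLabel, if_neg (by omega)]
      · obtain ⟨k, e1, e2⟩ := iha (x := leftLabel j) hj h4 (by omega)
        exact ⟨k, by rw [paint_left h3, e1], fun m hm => by rw [paint_left h3, e2 m hm]⟩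
    · obtain ⟨k, e1, e2⟩ := ihb (x := y) (j := j + a.numNodes + 1) (by omega) h1 h3
      have hk := paint_support
        (by rw [e1]; simp : paint y b i (j + a.numNodes + 1) r k ≠ none)
      refine ⟨k, by rw [paint_right h3 (by omega), e1], fun m hm => ?_⟩
      rcases Nat.lt_or_ge (j + a.numNodes) m with h4 | h4
      · rw [paint_right h3 h4, e2 m hm]
      · exact paint_middle h3 h4 (by omega)

/-- The top-most label of a column to the right of the column of the root is `α`. -/
theorem AllAlpha.paint_first_in_col {s : BinaryTree NodeLabel} : ∀ {x i j c}, AllAlpha s →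
    j < c → c ≤ j + s.numNodes → ∃ k, paint x s i j k c = some (NodeLabel.lab Label.α) ∧
      ∀ m < k, paint x s i j m c = none := by
  induction s with
  | nil => intro x i j c _ h1 h2; simp at h2; omega
  | node y a b iha ihb =>
    intro x i j c hs h1 h2
    rw [BinaryTree.numNodes] at h2
    rcases Nat.lt_or_ge (j + a.numNodes) c with h3 | h3
    · rcases Nat.eq_or_lt_of_le (show j + a.numNodes + 1 ≤ c from h3) with h4 | h4
      · refine ⟨i, ?_, fun m hm => paint_eq_none (by omega)⟩
        rw [paint_right (by omega) h3, ← h4, paint_root, hs.1]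
      · obtain ⟨k, e1, e2⟩ := ihb (x := y) (i := i) hs.2.2 h4 (by omega)
        have hk := paint_support
          (by rw [e1]; simp : paint y b i (j + a.numNodes + 1) k c ≠ none)
        exact ⟨k, by rw [paint_right (by omega) h3, e1],
          fun m hm => by rw [paint_right (by omega) h3, e2 m hm]⟩
    · obtain ⟨k, e1, e2⟩ := iha (x := leftLabel j) (i := i + b.numNodes + 1) hs.2.1 h1 h3
      have hk := paint_support
        (by rw [e1]; simp : paint (leftLabel j) a (i + b.numNodes + 1) j k c ≠ none)
      refine ⟨k, by rw [paint_left (by omega), e1], fun m hm => ?_⟩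
      rcases Nat.lt_or_ge (i + b.numNodes) m with h4 | h4
      · rw [paint_left h4, e2 m hm]
      · exact paint_middle h4 h3 (by omega)

/-- The box `(r, c)` sees `β` to its right or `α` below it. -/
def SeesBetaOrAlpha (f : ℕ → ℕ → Option NodeLabel) (r c : ℕ) : Prop :=
  (∃ k, c < k ∧ f r k = some (NodeLabel.lab Label.β) ∧ ∀ m, c < m → m < k → f r m = none) ∨
    ∃ k, r < k ∧ f k c = some (NodeLabel.lab Label.α) ∧ ∀ m, r < m → m < k → f m c = none

section Sees

variable {x y : NodeLabel} {a b : BinaryTree NodeLabel} {i j r c : ℕ}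

theorem SeesBetaOrAlpha.of_left (h : i + b.numNodes < r)
    (hs : SeesBetaOrAlpha (paint (leftLabel j) a (i + b.numNodes + 1) j) r c) :
    SeesBetaOrAlpha (paint x (node y a b) i j) r c := by
  rcases hs with ⟨k, h1, h2, h3⟩ | ⟨k, h1, h2, h3⟩
  · refine Or.inl ⟨k, h1, by rw [paint_left h, h2], fun m hm hmk => ?_⟩
    rw [paint_left h, h3 m hm hmk]
  · refine Or.inr ⟨k, h1, by rw [paint_left (by omega), h2], fun m hm hmk => ?_⟩
    rw [paint_left (by omega), h3 m hm hmk]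

theorem SeesBetaOrAlpha.of_right (h : r ≤ i + b.numNodes) (hc : j + a.numNodes < c)
    (hs : SeesBetaOrAlpha (paint y b i (j + a.numNodes + 1)) r c) :
    SeesBetaOrAlpha (paint x (node y a b) i j) r c := by
  rcases hs with ⟨k, h1, h2, h3⟩ | ⟨k, h1, h2, h3⟩
  · refine Or.inl ⟨k, h1, by rw [paint_right h (by omega), h2], fun m hm hmk => ?_⟩
    rw [paint_right h (by omega), h3 m hm hmk]
  · have hk := paint_support
      (by rw [h2]; simp : paint y b i (j + a.numNodes + 1) k c ≠ none)
    refine Or.inr ⟨k, h1, by rw [paint_right (by omega) hc, h2], fun m hm hmk => ?_⟩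
    rw [paint_right (by omega) hc, h3 m hm hmk]

/-- To the right of the empty rectangle, each row starts with a β of the right subtree. -/
theorem seesBetaOrAlpha_of_row (hi : i < r) (h : r ≤ i + b.numNodes)
    (hc : c ≤ j + a.numNodes) : SeesBetaOrAlpha (paint x (node y a b) i j) r c := by
  obtain ⟨k, e1, e2⟩ := paint_first_in_row (x := y) (j := j + a.numNodes + 1) (by omega) hi h
  have hk := paint_support
    (by rw [e1]; simp : paint y b i (j + a.numNodes + 1) r k ≠ none)
  refine Or.inl ⟨k, by omega, by rw [paint_right h (by omega), e1], fun m hm hmk => ?_⟩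
  rcases Nat.lt_or_ge (j + a.numNodes) m with h4 | h4
  · rw [paint_right h h4, e2 m hmk]
  · exact paint_middle h h4 (by omega)

theorem seesBetaOrAlpha_of_col (ha : AllAlpha a) (hj : j < c) (hc : c ≤ j + a.numNodes) :
    SeesBetaOrAlpha (paint x (node y a b) i j) i c := by
  obtain ⟨k, e1, e2⟩ := ha.paint_first_in_col (x := leftLabel j) (i := i + b.numNodes + 1) hj hc
  have hk := paint_support
    (by rw [e1]; simp : paint (leftLabel j) a (i + b.numNodes + 1) j k c ≠ none)
  refine Or.inr ⟨k, by omega, by rw [paint_left (by omega), e1], fun m hm hmk => ?_⟩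
  rcases Nat.lt_or_ge (i + b.numNodes) m with h4 | h4
  · rw [paint_left h4, e2 m hmk]
  · exact paint_middle h4 hc (by omega)

end Sees

/-- A blank box lies inside a subtree, in the rectangle between the subtrees (it sees a β), in the
column of the root (again a β), or in the row of the root (it sees an α, as the left subtree carries
only α). -/
theorem SideAdmissible.seesBetaOrAlpha {s : BinaryTree NodeLabel} : ∀ {x i j r c},
    SideAdmissible s → i ≤ r → j ≤ c → r + c ≤ i + j + s.numNodes →
    paint x s i j r c = none → SeesBetaOrAlpha (paint x s i j) r c := by
  induction s with
  | nil =>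
    intro x i j r c _ h1 h2 h3 h
    rw [BinaryTree.numNodes] at h3
    rw [paint, if_pos (by omega)] at h
    cases h
  | node y a b iha ihb =>
    intro x i j r c hs h1 h2 h3 h
    rw [BinaryTree.numNodes] at h3
    rcases Nat.lt_or_ge (i + b.numNodes) r with h4 | h4
    · rw [paint_left h4] at h
      exact (iha hs.2.1.sideAdmissible h4 h2 (by omega) h).of_left h4
    · rcases Nat.lt_or_ge (j + a.numNodes) c with h5 | h5
      · rw [paint_right h4 h5] at h
        exact (ihb hs.2.2 h1 h5 (by omega) h).of_right h4 h5
      · rcases Nat.eq_or_lt_of_le h1 with rfl | h6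
        · refine seesBetaOrAlpha_of_col hs.2.1 (Nat.lt_of_le_of_ne h2 ?_) h5
          rintro rfl
          rw [paint_root] at h
          cases h
        · exact seesBetaOrAlpha_of_row h6 h4 h5

theorem Admissible.seesBetaOrAlpha {s : BinaryTree NodeLabel} : ∀ {x j r c},
    Admissible s → 0 < r → j ≤ c → r + c ≤ j + s.numNodes →
    paint x s 0 j r c = none → SeesBetaOrAlpha (paint x s 0 j) r c := by
  induction s with
  | nil => intro x j r c _ h1 h2 h3; simp at h3; omega
  | node y a b _ ihb =>
    intro x j r c hs h1 h2 h3 h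
    rw [BinaryTree.numNodes] at h3
    rcases Nat.lt_or_ge (0 + b.numNodes) r with h4 | h4
    · rw [paint_left h4] at h
      exact (hs.2.1.seesBetaOrAlpha h4 h2 (by omega) h).of_left h4
    · rcases Nat.lt_or_ge (j + a.numNodes) c with h5 | h5
      · rw [paint_right h4 h5] at h
        exact (ihb hs.2.2 h1 h5 (by omega) h).of_right h4 h5
      · exact seesBetaOrAlpha_of_row h1 h4 h5

/-- Each label is a left or a right son, which settles the emptiness rules; a box that sees β to its
right or α below it cannot have weight q. -/
theorem Admissible.isHooked_paint {n : ℕ} {t : BinaryTree NodeLabel} (ht : Admissible t)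
    (hn : t.numNodes = n + 1) : IsHooked n (paint NodeLabel.one t 0 0) where
  outside := fun r c h => paint_eq_none (by omega)
  diagonal := fun r c h => paint_diagonal (Nat.zero_le _) (Nat.zero_le _) (by omega)
  corner := paint_root _ _ _ _
  row_zero := by
    intro c x h
    by_cases hc : c = 0
    · subst hc
      rw [paint_root] at h
      exact (Option.some.inj h).symm
    · rcases ht.paint_label h (by omega) with h1 | h1 | h1
      · omega
      · omega
      · exact h1.2
  col_zero := by
    intro r x h
    by_cases hr : r = 0
    · subst hr
      rw [paint_root] at h
      exact (Option.some.inj h).symm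
    · rcases ht.paint_label h (by omega) with h1 | h1 | h1
      · rw [h1.2, leftLabel, if_pos rfl]
      · omega
      · exact h1.2
  inner := by
    intro r c x hr hc h
    rcases ht.paint_label h (by omega) with h1 | h1 | h1
    · left
      rw [h1.2, leftLabel, if_neg (by omega)]
    · exact Or.inr h1.2.2
    · omega
  beta_left := by
    intro r c c' h hc
    exact (paint_beta ht.noBeta h (by omega)).1 c' hc
  beta_above := by
    intro r c h
    refine (paint_beta ht.noBeta h ?_).2
    rintro ⟨rfl, rfl⟩
    rw [paint_root] at h
    cases h
  row_above := by
    intro r c r' x h hx hr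
    exact (paint_row h hx (by omega)).1 r' hr
  row_left := by
    intro r c x h hx
    refine (paint_row h hx ?_).2
    rintro ⟨rfl, rfl⟩
    rw [paint_root] at h
    cases h
    rcases hx with h | h <;> cases h
  no_q := by
    intro r c r' c' x y hr hc hrc h0 hR hx hxr hB hy hyb
    rcases ht.seesBetaOrAlpha hr (Nat.zero_le c) (by omega) h0 with
      ⟨k, h1, h2, h3⟩ | ⟨k, h1, h2, h3⟩
    · have hk : k = c' := by
        rcases lt_trichotomy k c' with h4 | h4 | h4
        · rw [hR.2.2 k h1 h4] at h2; cases h2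
        · exact h4
        · exact absurd (h3 c' hR.1 h4) hR.2.1
      rw [← hk, h2] at hx
      cases hx
      rcases hxr with h | h <;> cases h
    · have hk : k = r' := by
        rcases lt_trichotomy k r' with h4 | h4 | h4
        · rw [hB.2.2 k h1 h4] at h2; cases h2
        · exact h4
        · exact absurd (h3 r' hB.1 h4) hB.2.1
      rw [← hk, h2] at hy
      cases hy
      rcases hyb with h | h <;> cases h

/-! The tableau of a hooked diagram -/

/-- The label of the tableau under a node label. -/
def NodeLabel.toLabel : NodeLabel → Option Label
  | one => none
  | lab x => some x

section OfHooked

variable {n : ℕ} {f : ℕ → ℕ → Option NodeLabel}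

theorem bind_toLabel_eq_some {o : Option NodeLabel} {x : Label} :
    o.bind NodeLabel.toLabel = some x ↔ o = some (NodeLabel.lab x) := by
  rcases o with _ | _ | y <;> simp [NodeLabel.toLabel]

theorem IsHooked.bind_toLabel_eq_none (hf : IsHooked n f) {i j : ℕ} :
    (f (i + 1) (j + 1)).bind NodeLabel.toLabel = none ↔ f (i + 1) (j + 1) = none := by
  constructor
  · intro h
    by_contra hne
    obtain ⟨x, hx⟩ := Option.ne_none_iff_exists'.1 hne
    rw [hx] at h
    rcases hf.inner _ _ _ (by omega) (by omega) hx with rfl | rfl | rfl <;> cases h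
  · intro h
    rw [h]; rfl

/-- The tableau with a given hooked diagram. -/
def IsHooked.tableau (hf : IsHooked n f) : Tableau n where
  label i j := (f (i + 1) (j + 1)).bind NodeLabel.toLabel
  outside i j h := hf.bind_toLabel_eq_none.2 (hf.outside _ _ (by omega))
  diagonal i j h := fun h' => hf.diagonal _ _ (by omega) (hf.bind_toLabel_eq_none.1 h')
  left_empty := by
    rintro i j k (h | h) hk
    · exact hf.bind_toLabel_eq_none.2 (hf.beta_left _ _ _ (bind_toLabel_eq_some.1 h) (by omega))
    · rcases hf.inner _ _ _ (by omega) (by omega) (bind_toLabel_eq_some.1 h) with h | h | h <;>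
        cases h
  above_empty := by
    rintro i j k (h | h) hk
    · exact hf.bind_toLabel_eq_none.2
        (hf.row_above _ _ _ _ (bind_toLabel_eq_some.1 h) (Or.inl rfl) (by omega))
    · exact hf.bind_toLabel_eq_none.2
        (hf.row_above _ _ _ _ (bind_toLabel_eq_some.1 h) (Or.inr rfl) (by omega))

theorem IsHooked.tableau_label (hf : IsHooked n f) {i j : ℕ} {x : Label} :
    hf.tableau.label i j = some x ↔ f (i + 1) (j + 1) = some (NodeLabel.lab x) :=
  bind_toLabel_eq_some

theorem IsHooked.tableau_label_none (hf : IsHooked n f) {i j : ℕ} :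
    hf.tableau.label i j = none ↔ f (i + 1) (j + 1) = none :=
  hf.bind_toLabel_eq_none

theorem IsHooked.tableau_label_ne_delta (hf : IsHooked n f) (i j : ℕ) :
    hf.tableau.label i j ≠ some Label.δ := by
  intro h
  rcases hf.inner _ _ _ (by omega) (by omega) (hf.tableau_label.1 h) with h | h | h <;> cases h

theorem IsHooked.noDeltaNoQ_tableau (hf : IsHooked n f) : hf.tableau.NoDeltaNoQ := by
  refine ⟨hf.tableau_label_ne_delta, ?_⟩
  rintro i j ⟨hij, h0, h | ⟨hR, hB⟩⟩
  · obtain ⟨k, -, -, h, -⟩ := (Tableau.seesRight_eq_some _ _ _ _).1 h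
    exact hf.tableau_label_ne_delta _ _ h
  · obtain ⟨x, hx, hR⟩ : ∃ x, IsRow (NodeLabel.lab x) ∧ hf.tableau.seesRight i j = some x := by
      rcases hR with h | h
      · exact ⟨_, Or.inl rfl, h⟩
      · exact ⟨_, Or.inr rfl, h⟩
    obtain ⟨y, hy, hB⟩ : ∃ y, (NodeLabel.lab y = NodeLabel.lab Label.β ∨
        NodeLabel.lab y = NodeLabel.lab Label.γ) ∧ hf.tableau.seesBelow i j = some y := by
      rcases hB with h | h
      · exact ⟨_, Or.inl rfl, h⟩
      · exact ⟨_, Or.inr rfl, h⟩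
    obtain ⟨k, -, h1, h2, h3⟩ := (Tableau.seesRight_eq_some _ _ _ _).1 hR
    obtain ⟨l, -, h4, h5, h6⟩ := (Tableau.seesBelow_eq_some _ _ _ _).1 hB
    rw [hf.tableau_label] at h2 h5
    refine hf.no_q (i + 1) (j + 1) (l + 1) (k + 1) _ _ (by omega) (by omega) (by omega)
      (hf.tableau_label_none.1 h0) ⟨by omega, by simp [h2], ?_⟩ h2 hx
      ⟨by omega, by simp [h5], ?_⟩ h5 hy
    · rintro (_ | m) h7 h8
      · omega
      · exact hf.tableau_label_none.1 (h3 m (by omega) (by omega))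
    · rintro (_ | m) h7 h8
      · omega
      · exact hf.tableau_label_none.1 (h6 m (by omega) (by omega))

/-- Nothing is lost by removing the hook: away from its ends, a 1 in the first row stands exactly
above the columns whose top label is β, by `beta_above` and `row_above`, and likewise for the first
column. -/
theorem IsHooked.hooked_tableau (hf : IsHooked n f) : hf.tableau.hooked = f := by
  have hδ := hf.tableau_label_ne_delta
  funext r c
  rcases r with _ | i <;> rcases c with _ | j
  · exact hf.corner.symm
  · have key : (j = n ∨ hf.tableau.colIndex j = some Label.β ∨
        hf.tableau.colIndex j = some Label.δ) ↔ f 0 (j + 1) ≠ none := by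
      constructor
      · rintro (h | h | h)
        · exact hf.diagonal _ _ (by omega)
        · obtain ⟨k, -, h1, h2⟩ := (Tableau.colIndex_eq_some _ _ _).1 h
          obtain ⟨r, hr, h3⟩ := hf.beta_above _ _ (hf.tableau_label.1 h1)
          rcases r with _ | r
          · exact h3
          · exact absurd (hf.tableau_label_none.1 (h2 r (by omega))) h3
        · obtain ⟨k, -, h1, h2⟩ := (Tableau.colIndex_eq_some _ _ _).1 h
          exact absurd h1 (hδ _ _)
      · intro h
        by_cases hj : j = n
        · exact Or.inl hj
        · have := hf.le_of_ne_none h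
          obtain ⟨x, hx⟩ := hf.tableau.exists_colIndex (j := j) (by omega)
          obtain ⟨k, -, h1, h2⟩ := (Tableau.colIndex_eq_some _ _ _).1 hx
          have h1' := hf.tableau_label.1 h1
          cases x
          · exact absurd (hf.row_above _ _ 0 _ h1' (Or.inl rfl) (by omega)) h
          · exact Or.inr (Or.inl hx)
          · exact absurd (hf.row_above _ _ 0 _ h1' (Or.inr rfl) (by omega)) h
          · exact absurd h1 (hδ _ _)
    simp only [Tableau.hooked, key]
    split_ifs with h
    · obtain ⟨x, hx⟩ := Option.ne_none_iff_exists'.1 h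
      rw [hx, hf.row_zero _ _ hx]
    · exact (not_not.1 h).symm
  · have key : (i = n ∨ hf.tableau.rowIndex i = some Label.α ∨
        hf.tableau.rowIndex i = some Label.γ) ↔ f (i + 1) 0 ≠ none := by
      constructor
      · intro h
        by_cases hi : i = n
        · exact hf.diagonal _ _ (by omega)
        · obtain ⟨x, hx, h⟩ : ∃ x, IsRow (NodeLabel.lab x) ∧
              hf.tableau.rowIndex i = some x := by
            rcases h with h | h | h
            · exact absurd h hi
            · exact ⟨_, Or.inl rfl, h⟩
            · exact ⟨_, Or.inr rfl, h⟩
          obtain ⟨k, -, h1, h2⟩ := (Tableau.rowIndex_eq_some _ _ _).1 h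
          obtain ⟨c, hc, h3⟩ := hf.row_left _ _ _ (hf.tableau_label.1 h1) hx
          rcases c with _ | c
          · exact h3
          · exact absurd (hf.tableau_label_none.1 (h2 c (by omega))) h3
      · intro h
        by_cases hi : i = n
        · exact Or.inl hi
        · have := hf.le_of_ne_none h
          obtain ⟨x, hx⟩ := hf.tableau.exists_rowIndex (i := i) (by omega)
          obtain ⟨k, -, h1, h2⟩ := (Tableau.rowIndex_eq_some _ _ _).1 hx
          have h1' := hf.tableau_label.1 h1
          cases x
          · exact Or.inr (Or.inl hx)
          · exact absurd (hf.beta_left _ _ 0 h1' (by omega)) h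
          · exact Or.inr (Or.inr hx)
          · exact absurd h1 (hδ _ _)
    simp only [Tableau.hooked, key]
    split_ifs with h
    · obtain ⟨x, hx⟩ := Option.ne_none_iff_exists'.1 h
      rw [hx, hf.col_zero _ _ hx]
    · exact (not_not.1 h).symm
  · rw [Tableau.hooked_succ_succ]
    rcases h : hf.tableau.label i j with _ | x
    · rw [hf.tableau_label_none.1 h]; rfl
    · rw [hf.tableau_label.1 h]; rfl

end OfHooked

/-- Remove the hook from the painted diagram; the tree of the resulting tableau paints the same
diagram, hence is the given tree. -/
theorem Admissible.exists_tableau {n : ℕ} {t : BinaryTree NodeLabel} (ht : Admissible t)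
    (hn : t.numNodes = n + 1) : ∃ T : Tableau n, T.NoDeltaNoQ ∧ T.tree = t := by
  have hf := ht.isHooked_paint hn
  refine ⟨hf.tableau, hf.noDeltaNoQ_tableau, ?_⟩
  obtain ⟨h1, h2⟩ := hf.tableau.hooked_eq_paint hf.noDeltaNoQ_tableau.isHooked
  refine paint_inj (x := NodeLabel.one) (x' := NodeLabel.one) (i := 0) (j := 0)
    (by rw [h1, hn]) fun r c _ _ => ?_
  rw [← h2, hf.hooked_tableau]

/-! ### The bijection -/

theorem bijOn_Φ (n : ℕ) : Set.BijOn (Φ (n := n)) {T : Tableau n | T.NoDeltaNoQ}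
    {p : List Step | IsLazyPath n p} := by
  refine ⟨?_, ?_, ?_⟩
  · intro T hT
    have hf := Tableau.NoDeltaNoQ.isHooked hT
    change IsLazyPath n (Φ T)
    rw [Φ_eq_spinePath]
    exact isLazyPath_spinePath (T.hooked_eq_paint hf).1
  · intro S hS T hT h
    have hS' := Tableau.NoDeltaNoQ.isHooked hS
    have hT' := Tableau.NoDeltaNoQ.isHooked hT
    obtain ⟨s1, s2⟩ := S.hooked_eq_paint hS'
    obtain ⟨t1, t2⟩ := T.hooked_eq_paint hT'
    rw [Φ_eq_spinePath, Φ_eq_spinePath] at h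
    have := spinePath_injOn (S.admissible_tree hS') (T.admissible_tree hT')
      (by intro h; simp [h] at s1) (by intro h; simp [h] at t1) h
    exact Tableau.eq_of_hooked_eq (by rw [s2, t2, this])
  · intro p hp
    obtain ⟨t, ht, hn, rfl⟩ := IsLazyPath.exists_tree hp
    obtain ⟨T, hT, rfl⟩ := ht.exists_tableau hn
    exact ⟨T, hT, Φ_eq_spinePath T⟩

/-! Counting labels -/

/-- The number of boxes labeled `z` in the first `N` rows and columns. -/
def boxCount (N : ℕ) (f : ℕ → ℕ → Option NodeLabel) (z : NodeLabel) : ℕ :=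
  ∑ r ∈ Finset.range N, ∑ c ∈ Finset.range N, if f r c = some z then 1 else 0

theorem sum_single_box {N i j : ℕ} (hi : i < N) (hj : j < N) (P : Prop) [Decidable P] :
    (∑ r ∈ Finset.range N, ∑ c ∈ Finset.range N, if (r = i ∧ c = j) ∧ P then 1 else 0) =
      if P then 1 else 0 := by
  rw [Finset.sum_eq_single i, Finset.sum_eq_single j]
  · simp
  · intro c _ hc; simp [hc]
  · intro h; exact absurd (Finset.mem_range.2 hj) h
  · intro r _ hr; simp [hr]
  · intro h; exact absurd (Finset.mem_range.2 hi) h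

theorem boxCount_paint_nil {N i j : ℕ} (hi : i < N) (hj : j < N) (x z : NodeLabel) :
    boxCount N (paint x nil i j) z = if x = z then 1 else 0 := by
  rw [boxCount, ← sum_single_box hi hj]
  refine Finset.sum_congr rfl fun r _ => Finset.sum_congr rfl fun c _ => ?_
  rw [paint]
  by_cases h : r = i ∧ c = j <;> simp [h]

theorem boxCount_paint_node {N i j : ℕ} (x y z : NodeLabel) (a b : BinaryTree NodeLabel)
    (hi : i < N) (hj : j < N) :
    boxCount N (paint x (node y a b) i j) z = (if x = z then 1 else 0) +
      boxCount N (paint (leftLabel j) a (i + b.numNodes + 1) j) z +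
      boxCount N (paint y b i (j + a.numNodes + 1)) z := by
  simp only [boxCount]
  rw [← sum_single_box hi hj, ← Finset.sum_add_distrib, ← Finset.sum_add_distrib]
  refine Finset.sum_congr rfl fun r _ => ?_
  rw [← Finset.sum_add_distrib, ← Finset.sum_add_distrib]
  refine Finset.sum_congr rfl fun c _ => ?_
  rcases Nat.lt_or_ge (i + b.numNodes) r with h1 | h1
  · rw [paint_left h1, paint_eq_none (s := b) (by omega),
      if_neg (fun h : (r = i ∧ c = j) ∧ x = z => by omega)]
    simp
  · rw [paint_eq_none (s := a) (by omega)]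
    rcases Nat.lt_or_ge (j + a.numNodes) c with h2 | h2
    · rw [paint_right h1 h2, if_neg (fun h : (r = i ∧ c = j) ∧ x = z => by omega)]
      simp
    · rw [paint_eq_none (s := b) (by omega)]
      by_cases h3 : r = i ∧ c = j
      · rw [h3.1, h3.2, paint_root]
        simp
      · rw [paint_middle h1 h2 h3]
        simp [h3]

/-- Left sons are 1 or β, so every α or γ other than the root is a right son, recorded by its
father. -/
theorem boxCount_paint {N : ℕ} {z : NodeLabel} (hz : IsRow z) {s : BinaryTree NodeLabel} :
    ∀ {x i j}, i + j + s.numNodes < N →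
      boxCount N (paint x s i j) z = (if x = z then 1 else 0) + labelCount z s := by
  have hl (j : ℕ) : leftLabel j ≠ z := fun h => not_isRow_leftLabel j (h ▸ hz)
  induction s with
  | nil => intro x i j h; rw [boxCount_paint_nil (by omega) (by omega)]; rfl
  | node y a b iha ihb =>
    intro x i j h
    rw [BinaryTree.numNodes] at h
    rw [boxCount_paint_node _ _ _ _ _ (by omega) (by omega), iha (by omega), ihb (by omega),
      if_neg (hl j), labelCount]
    omega

/-- Each internal node has one left son, which is β unless it lies in column 0, where the left spine
accounts for the missing ones. -/
theorem boxCount_beta_paint {N : ℕ} {s : BinaryTree NodeLabel} :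
    ∀ {x i j}, NoBeta s → i + j + s.numNodes < N →
      boxCount N (paint x s i j) (NodeLabel.lab Label.β) + (if j = 0 then leftLength s else 0) =
        (if x = NodeLabel.lab Label.β then 1 else 0) + s.numNodes := by
  induction s with
  | nil => intro x i j _ h; rw [boxCount_paint_nil (by omega) (by omega)]; simp [leftLength]
  | node y a b iha ihb =>
    intro x i j hs h
    rw [BinaryTree.numNodes] at h
    have h1 := iha (x := leftLabel j) (i := i + b.numNodes + 1) (j := j) hs.2.1 (by omega)
    have h2 := ihb (x := y) (i := i) (j := j + a.numNodes + 1) hs.2.2 (by omega)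
    rw [boxCount_paint_node _ _ _ _ _ (by omega) (by omega), BinaryTree.numNodes, leftLength]
    rw [if_neg hs.1, if_neg (by omega)] at h2
    by_cases hj : j = 0
    · rw [if_pos hj] at h1 ⊢
      rw [leftLabel, if_pos hj] at h1 ⊢
      rw [if_neg (by simp)] at h1
      omega
    · rw [if_neg hj] at h1 ⊢
      rw [leftLabel, if_neg hj] at h1 ⊢
      rw [if_pos rfl] at h1
      omega

theorem count_row_paint {N : ℕ} {s : BinaryTree NodeLabel} : ∀ {x i j}, j + s.numNodes < N →
    (∑ c ∈ Finset.range N, if paint x s i j i c ≠ none then 1 else 0) = rightLength s + 1 := by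
  induction s with
  | nil =>
    intro x i j h
    rw [BinaryTree.numNodes] at h
    rw [Finset.sum_eq_single j]
    · simp [paint, rightLength]
    · intro c _ hc; simp [paint, hc]
    · intro h'; exact absurd (Finset.mem_range.2 (by omega)) h'
  | node y a b _ ihb =>
    intro x i j h
    rw [BinaryTree.numNodes] at h
    rw [rightLength, ← ihb (x := y) (i := i) (j := j + a.numNodes + 1) (by omega)]
    have h1 : (∑ c ∈ Finset.range N, if c = j then 1 else 0) = 1 := by
      rw [Finset.sum_ite_eq' (Finset.range N) j]
      exact if_pos (Finset.mem_range.2 (by omega))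
    refine Eq.trans ?_ (congrArg₂ (· + ·) rfl h1)
    rw [← Finset.sum_add_distrib]
    refine Finset.sum_congr rfl fun c _ => ?_
    rcases Nat.lt_or_ge (j + a.numNodes) c with h2 | h2
    · rw [paint_right (by omega) h2, if_neg (c := c = j) (by omega)]
      simp
    · rw [paint_eq_none (s := b) (by omega)]
      by_cases h3 : c = j
      · rw [h3, paint_root]
        simp
      · rw [paint_middle (by omega) h2 (by omega)]
        simp [h3]

theorem count_col_paint {N : ℕ} {s : BinaryTree NodeLabel} : ∀ {x i j}, i + s.numNodes < N →
    (∑ r ∈ Finset.range N, if paint x s i j r j ≠ none then 1 else 0) = leftLength s + 1 := by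
  induction s with
  | nil =>
    intro x i j h
    rw [BinaryTree.numNodes] at h
    rw [Finset.sum_eq_single i]
    · simp [paint, leftLength]
    · intro c _ hc; simp [paint, hc]
    · intro h'; exact absurd (Finset.mem_range.2 (by omega)) h'
  | node y a b iha _ =>
    intro x i j h
    rw [BinaryTree.numNodes] at h
    rw [leftLength, ← iha (x := leftLabel j) (i := i + b.numNodes + 1) (j := j) (by omega)]
    have h1 : (∑ r ∈ Finset.range N, if r = i then 1 else 0) = 1 := by
      rw [Finset.sum_ite_eq' (Finset.range N) i]
      exact if_pos (Finset.mem_range.2 (by omega))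
    refine Eq.trans ?_ (congrArg₂ (· + ·) rfl h1)
    rw [← Finset.sum_add_distrib]
    refine Finset.sum_congr rfl fun r _ => ?_
    rcases Nat.lt_or_ge (i + b.numNodes) r with h2 | h2
    · rw [paint_left h2, if_neg (c := r = i) (by omega)]
      simp
    · rw [paint_eq_none (s := a) (by omega)]
      by_cases h3 : r = i
      · rw [h3, paint_root]
        simp
      · rw [paint_middle h2 (by omega) (by omega)]
        simp [h3]

/-! ### Reading the statistics off the tree -/

section Statistics

variable {n : ℕ} (T : Tableau n)

theorem Tableau.numLabel_eq_boxCount (x : Label) :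
    T.numLabel x = boxCount (n + 2) T.hooked (NodeLabel.lab x) := by
  have hrow (c : ℕ) : T.hooked 0 c ≠ some (NodeLabel.lab x) := fun h => by
    have := T.hooked_row_zero h; cases this
  have hcol (r : ℕ) : T.hooked r 0 ≠ some (NodeLabel.lab x) := fun h => by
    have := T.hooked_col_zero h; cases this
  have hr (j : ℕ) : T.label n j = none := T.outside _ _ (by omega)
  have hc (i : ℕ) : T.label i n = none := T.outside _ _ (by omega)
  rw [Tableau.numLabel, Finset.card_filter, Finset.sum_product, boxCount, Finset.sum_range_succ',
    Finset.sum_range_succ]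
  simp only [Finset.sum_range_succ' _ (n + 1), Finset.sum_range_succ _ n, hrow, hcol,
    T.hooked_eq_some_lab, hr, hc]
  simp

/-- The 2 stands for the labels 1 in the corner and at the end of the first row. -/
theorem Tableau.NoDeltaNoQ.numColBeta_eq {T : Tableau n} (hT : T.NoDeltaNoQ) :
    T.numColBeta + 2 = ∑ c ∈ Finset.range (n + 2), if T.hooked 0 c ≠ none then 1 else 0 := by
  have hδ (j : ℕ) : T.colIndex j ≠ some Label.δ := fun h => by
    obtain ⟨k, -, h1, -⟩ := (T.colIndex_eq_some _ _).1 h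
    exact hT.1 _ _ h1
  rw [Finset.sum_range_succ', Finset.sum_range_succ, Tableau.numColBeta, Finset.card_filter]
  simp only [Tableau.hooked, hδ, or_false, true_or, if_true]
  simp only [ne_eq, reduceCtorEq, not_false_eq_true, if_true]
  rw [add_assoc]
  refine congrArg (· + 2) ?_
  refine Finset.sum_congr rfl fun j hj => ?_
  have : j ≠ n := (Finset.mem_range.1 hj).ne
  by_cases h : T.colIndex j = some Label.β <;> simp [this, h]

theorem Tableau.numRowAlphaGamma_eq :
    T.numRowAlphaGamma + 2 =
      ∑ r ∈ Finset.range (n + 2), if T.hooked r 0 ≠ none then 1 else 0 := by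
  rw [Finset.sum_range_succ', Finset.sum_range_succ, Tableau.numRowAlphaGamma, Finset.card_filter]
  simp only [Tableau.hooked, true_or, if_true]
  simp only [ne_eq, reduceCtorEq, not_false_eq_true, if_true]
  rw [add_assoc]
  refine congrArg (· + 2) ?_
  refine Finset.sum_congr rfl fun i hi => ?_
  have : i ≠ n := (Finset.mem_range.1 hi).ne
  by_cases h : T.rowIndex i = some Label.α ∨ T.rowIndex i = some Label.γ <;> simp [this, h]

theorem Tableau.NoDeltaNoQ.statistics {T : Tableau n} (hT : T.NoDeltaNoQ) :
    T.numLabel Label.γ = numNegative (Φ T) ∧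
      (T.numLabel Label.α : ℤ) = ((Φ T).count Step.up : ℤ) - numNegative (Φ T) ∧
      (T.numLabel Label.β : ℤ) =
        ((Φ T).count Step.down : ℤ) + (Φ T).count Step.flat - initialRun (Φ T) ∧
      T.numColBeta = (Φ T).count Step.flat ∧
      T.numRowAlphaGamma = initialRun (Φ T) := by
  have hf := hT.isHooked
  obtain ⟨hn, hp⟩ := T.hooked_eq_paint hf
  have ht := T.admissible_tree hf
  have hα : T.numLabel Label.α = labelCount (NodeLabel.lab Label.α) T.tree := by
    rw [T.numLabel_eq_boxCount, hp, boxCount_paint (Or.inl rfl) (by omega)]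
    simp
  have hγ : T.numLabel Label.γ = labelCount (NodeLabel.lab Label.γ) T.tree := by
    rw [T.numLabel_eq_boxCount, hp, boxCount_paint (Or.inr rfl) (by omega)]
    simp
  have hβ : T.numLabel Label.β + leftLength T.tree = T.tree.numNodes := by
    have := boxCount_beta_paint (N := n + 2) (x := NodeLabel.one) (i := 0) (j := 0) ht.noBeta
      (by omega)
    rw [T.numLabel_eq_boxCount, hp]
    simpa using this
  have hcol : T.numColBeta + 2 = rightLength T.tree + 1 := by
    rw [hT.numColBeta_eq, hp, count_row_paint (by omega)]
  have hrow : T.numRowAlphaGamma + 2 = leftLength T.tree + 1 := by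
    rw [T.numRowAlphaGamma_eq, hp, count_col_paint (by omega)]
  have h1 := count_spinePath (s := Step.up) (by decide) T.tree
  have h2 := count_spinePath (s := Step.down) (by decide) T.tree
  have h3 := count_flat_spinePath T.tree
  have h4 := initialRun_spinePath T.tree
  have h5 := numNegative_spinePath ht
  have h6 := ht.numNodes
  rw [Φ_eq_spinePath]
  -- With L and R the lengths of the left and right spines: D = M = n + 1 - R, H = R - 1, A = L - 1,
  -- and there are n + 1 - L labels β.
  refine ⟨?_, ?_, ?_, ?_, ?_⟩ <;> omega

end Statistics

end Staircase

theorem proposition5 (n : ℕ) :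
    Set.BijOn (Staircase.Φ (n := n))
      {T : Staircase.Tableau n | T.NoDeltaNoQ}
      {p : List Staircase.Step | Staircase.IsLazyPath n p} ∧
    ∀ T : Staircase.Tableau n, T.NoDeltaNoQ →
      T.numLabel Staircase.Label.γ = Staircase.numNegative (Staircase.Φ T) ∧
      (T.numLabel Staircase.Label.α : ℤ) =
        ((Staircase.Φ T).count Staircase.Step.up : ℤ) - Staircase.numNegative (Staircase.Φ T) ∧
      (T.numLabel Staircase.Label.β : ℤ) =
        ((Staircase.Φ T).count Staircase.Step.down : ℤ)
          + (Staircase.Φ T).count Staircase.Step.flat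
          - Staircase.initialRun (Staircase.Φ T) ∧
      T.numColBeta = (Staircase.Φ T).count Staircase.Step.flat ∧
      T.numRowAlphaGamma = Staircase.initialRun (Staircase.Φ T) := by
  exact ⟨Staircase.bijOn_Φ n, fun _ hT => hT.statistics⟩
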